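/- Let $\omega,\gamma,\lambda>0$ and $\nu^2=\gamma^2/\omega^2$. For $N\ge 2$ consider the chain of $N$ oscillators with phase-space vector $X=(q,p)\in\mathbb R^{2N}$ and bath temperatures $T=(T_1,\dots,T_N)$, $T_i\ge 0$, whose dynamics is the Ornstein–Uhlenbeck process $$dX=-AX\,dt+\Sigma\,dW,\qquad A=\begin{pmatrix}0&-I\\ \Phi&\lambda I\end{pmatrix},\qquad \Sigma=\begin{pmatrix}0&0\\0&\sqrt{2\lambda\,\mathrm{diag}(T)}\end{pmatrix},$$ where $\Phi=\omega^2(-\Delta+\nu^2 I)$ and $\Delta$ is the $N\times N$ discrete Laplacian with Dirichlet boundary conditions, $\Delta_{ij}=-2\delta_{i,j}+\delta_{i-1,j}+\delta_{i+1,j}$. A stationary state is a probability measure $\mu$ on $\mathbb R^{2N}$ that is invariant under this dynamics, i.e. for all $t\ge0$ the vector $e^{-tA}X(0)+\int_0^t e^{-(t-s)A}\Sigma\,dW(s)$ has law $\mu$ when $X(0)$ has law $\mu$ and is independent of the noise. Let $J_i=-\frac{\omega^2}{2}(q_{i+1}-q_i)(p_i+p_{i+1})$, $1\le i\le N-1$,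 be the energy currents and $R_i=\lambda(T_i-p_i^2)$ the energy flux from the $i$-th bath. Given $T_L,T_R\ge0$, a self-consistent stationary state is a pair $(T,\mu)$ such that $T_i\ge0$ for all $i$, $T_1=T_L$, $T_N=T_R$, $\mu$ is a stationary state for $T$, and $\langle R_i\rangle_\mu=0$ for $i=2,\dots,N-1$. Put $\varepsilon_N=\max_{1\le i<N}|T_i-T_{i+1}|$ and $$\kappa=\frac{\omega^2}{\lambda}\,\frac{1}{2+\nu^2+\sqrt{\nu^2(4+\nu^2)}} .$$ There is a constant $C$ depending only on $\omega,\gamma,\lambda$ such that the following holds for all $T_L,T_R\ge0$. For every $N\ge2$ there is exactly one self-consistent stationary state $(T^{(N)},\mu^{(N)})$, and in it: (1) the current is constant along the chain: the $J_i$ are integrable and $\langle J_i\rangle=J^{(N)}$ for all $1\le i\le N-1$; moreover $$\lim_{N\to\infty}(N-1)J^{(N)}=\kappa\,(T_L-T_R);$$ (2) $\varepsilon_N\le C\,|T_L-T_R|\,N^{-1/2}$ for all $N\ge2$; (3) for all $N\ge 2$ and $1\le j\le N$, $$\Bigl|T^{(N)}_j-T_L-\frac{j-1}{N-1}(T_R-T_L)\Bigr|\le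 C\,\varepsilon_N;$$ (4) the profile converges uniformly to the linear profile $T(x)=T_L+x(T_R-T_L)$: $\displaystyle\lim_{N\to\infty}\max_{1\le j\le N}\bigl|T^{(N)}_j-T(j/N)\bigr|=0$. -/

import Mathlib

open MeasureTheory ProbabilityTheory Filter Topology

noncomputable section

namespace HarmonicChain

/-- Phase space of `N` oscillators: the coordinate `Sum.inl i` is the position `q_i`, the
coordinate `Sum.inr i` is the momentum `p_i`. Sites `1, …, N` are numbered `0, …, N - 1`. -/
abbrev PhaseSpace (N : ℕ) : Type := EuclideanSpace ℝ (Fin N ⊕ Fin N)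

/-- Discrete Laplacian with Dirichlet boundary conditions. -/
def laplacian (N : ℕ) : Matrix (Fin N) (Fin N) ℝ :=
  Matrix.of fun i j =>
    if i = j then -2
    else if (i : ℕ) + 1 = (j : ℕ) ∨ (j : ℕ) + 1 = (i : ℕ) then 1
    else 0

/-- The square `ν² = γ² / ω²` of the dimensionless pinning parameter. -/
def nuSq (ω γ : ℝ) : ℝ := γ ^ 2 / ω ^ 2

/-- The force matrix `Φ = ω² (-Δ + ν² I)`. -/
def forceMatrix (ω γ : ℝ) (N : ℕ) : Matrix (Fin N) (Fin N) ℝ :=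
  ω ^ 2 • (-laplacian N + nuSq ω γ • (1 : Matrix (Fin N) (Fin N) ℝ))

/-- The drift matrix `A` of the Langevin equation `dX = -A X dt + Σ dW`. -/
def driftMatrix (ω γ lam : ℝ) (N : ℕ) : Matrix (Fin N ⊕ Fin N) (Fin N ⊕ Fin N) ℝ :=
  Matrix.fromBlocks 0 (-1) (forceMatrix ω γ N) (lam • (1 : Matrix (Fin N) (Fin N) ℝ))

/-- The noise matrix `Σ` of the Langevin equation `dX = -A X dt + Σ dW`. -/
def noiseMatrix (lam : ℝ) {N : ℕ} (T : Fin N → ℝ) :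
    Matrix (Fin N ⊕ Fin N) (Fin N ⊕ Fin N) ℝ :=
  Matrix.fromBlocks 0 0 0 (Matrix.diagonal fun i => √(2 * lam * T i))

/-- The propagator `exp (-t A)`. -/
def propagator (ω γ lam : ℝ) (N : ℕ) (t : ℝ) : Matrix (Fin N ⊕ Fin N) (Fin N ⊕ Fin N) ℝ :=
  NormedSpace.exp (-(t • driftMatrix ω γ lam N))

/-- Covariance `∫₀ᵗ exp (-s A) Σ Σᵀ exp (-s Aᵀ) ds` (entrywise) of the centred Gaussian vector
`∫₀ᵗ exp (-(t - s) A) Σ dW(s)`. -/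
def noiseCovariance (ω γ lam : ℝ) {N : ℕ} (T : Fin N → ℝ) (t : ℝ) :
    Matrix (Fin N ⊕ Fin N) (Fin N ⊕ Fin N) ℝ :=
  Matrix.of fun a b =>
    ∫ s in (0 : ℝ)..t,
      (propagator ω γ lam N s * (noiseMatrix lam T * (noiseMatrix lam T).transpose) *
        (propagator ω γ lam N s).transpose) a b

/-- Law at time `t` of the solution
`X(t) = exp (-t A) X(0) + ∫₀ᵗ exp (-(t - s) A) Σ dW(s)` of the Langevin equation, when `X(0)` has
law `μ` and is independent of the noise. -/
def lawAt (ω γ lam : ℝ) {N : ℕ} (T : Fin N → ℝ) (t : ℝ) (μ : Measure (PhaseSpace N)) :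
    Measure (PhaseSpace N) :=
  (μ.map (Matrix.toEuclideanCLM (𝕜 := ℝ) (propagator ω γ lam N t))) ∗
    multivariateGaussian 0 (noiseCovariance ω γ lam T t)

/-- `μ` is a stationary state of the chain with bath temperatures `T`. -/
structure IsStationary (ω γ lam : ℝ) {N : ℕ} (T : Fin N → ℝ) (μ : Measure (PhaseSpace N)) :
    Prop where
  isProbabilityMeasure : IsProbabilityMeasure μ
  lawAt_eq : ∀ t : ℝ, 0 ≤ t → lawAt ω γ lam T t μ = μ

/-- The site to the left of the bond `i`. -/
def leftSite {N : ℕ} (i : Fin (N - 1)) : Fin N := ⟨i, by omega⟩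

/-- The site to the right of the bond `i`. -/
def rightSite {N : ℕ} (i : Fin (N - 1)) : Fin N := ⟨i + 1, by omega⟩

/-- Energy current through a bond: `-(ω²/2) (q_{i+1} - q_i) (p_i + p_{i+1})`. -/
def energyCurrent (ω : ℝ) {N : ℕ} (i : Fin (N - 1)) (x : PhaseSpace N) : ℝ :=
  -(ω ^ 2 / 2) * (x (Sum.inl (rightSite i)) - x (Sum.inl (leftSite i))) *
    (x (Sum.inr (leftSite i)) + x (Sum.inr (rightSite i)))

/-- Energy flux `R_i = λ (T_i - p_i²)` from the `i`-th reservoir to the `i`-th oscillator. -/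
def bathFlux (lam : ℝ) {N : ℕ} (T : Fin N → ℝ) (i : Fin N) (x : PhaseSpace N) : ℝ :=
  lam * (T i - x (Sum.inr i) ^ 2)

/-- `T` is a self-consistent temperature profile with end-point temperatures `TL`, `TR`, and `μ`
is a stationary state for it: there is no average energy flux between the interior reservoirs and
the chain. -/
structure IsSelfConsistentState (ω γ lam TL TR : ℝ) {N : ℕ} (T : Fin N → ℝ)
    (μ : Measure (PhaseSpace N)) : Prop where
  nonneg : ∀ i, 0 ≤ T i
  left_end : ∀ i : Fin N, (i : ℕ) = 0 → T i = TL
  right_end : ∀ i : Fin N, (i : ℕ) + 1 = N → T i = TR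
  stationary : IsStationary ω γ lam T μ
  integrable_flux : ∀ i : Fin N, 0 < (i : ℕ) → (i : ℕ) + 1 < N → Integrable (bathFlux lam T i) μ
  flux_eq_zero : ∀ i : Fin N, 0 < (i : ℕ) → (i : ℕ) + 1 < N → ∫ x, bathFlux lam T i x ∂μ = 0

/-- Maximal nearest-neighbour variation `ε_N = max_{i < N} |T_i - T_{i+1}|` of a profile. -/
def maxVariation {N : ℕ} (T : Fin N → ℝ) : ℝ :=
  ⨆ i : Fin (N - 1), |T (leftSite i) - T (rightSite i)|

/-- The thermal conductivity `κ = (ω²/λ) / (2 + ν² + √(ν² (4 + ν²)))`. -/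
def conductivity (ω γ lam : ℝ) : ℝ :=
  ω ^ 2 / lam * (1 / (2 + nuSq ω γ + √(nuSq ω γ * (4 + nuSq ω γ))))

/-- The linear profile `T(x) = T_L + x (T_R - T_L)`. -/
def linearProfile (TL TR x : ℝ) : ℝ := TL + x * (TR - TL)

end HarmonicChain

end

/-! The drift is stable, so for given temperatures the only stationary law is the centred Gaussian
whose covariance solves the Lyapunov equation (`isStationary_iff`). Write U, Z, V for its
position-position, position-momentum and momentum-momentum blocks. They depend linearly on T, with V
= (ΦU + UΦ)/2, 2λZ = ΦU - UΦ and T = V + [Φ,[Φ,U]]/(4λ²). Self-consistency becomes V_ii = T_i at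
interior sites.

The map T ↦ (V_ii) is given by a kernel K that is nonnegative (positivity of covariances), has row
sums 1 (equal temperatures give the Gibbs state) and is symmetric (`kernel_comm`). A self-consistent
profile is therefore a K-harmonic function with prescribed end values. Two estimates uniform in N
control K: nearest-neighbour entries are bounded below (`kernelBound_le`), and the second moments of
the rows are bounded (`sum_kernel_mul_sq_le`), by comparison with temperatures whose covariance is
explicit. The lower bound gives the minimum principle `IsBalanced.le`, hence uniqueness, and
existence since the system is linear and finite. The Dirichlet principle with the linear trial
profile bounds the energy ∑ K_ij (T_i - T_j)² by O(|T_L - T_R|²/N), and a single bond of this sum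
yields ε_N = O(|T_L - T_R| N^(-1/2)).

The current is a discrete gradient: 2λ Z_{i,i+1} = ω² (P_i - P_{i+1}) with P_i = U_ii - U_{i-1,i+1}.
Energy conservation makes Z_{i,i+1} constant, so P is exactly affine in i. On the other hand P_i = g
T_i + O(ε_N), where g is the corner entry of Φ⁻¹ (`abs_potential_sub_le`). Hence T is affine up to
O(ε_N), and (N-1)J = ω⁴ g (T_L - T_R)/(2λ) + O(ε_N). Since g tends exponentially fast to r/ω², with
r the smaller root of r + 1/r = 2 + ν², Fourier's law follows with the stated κ. -/

namespace HarmonicChain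

/-! ### Matrix exponentials, stability and the Lyapunov equation. -/

section Lyapunov

open Matrix

variable {n : Type*} [Fintype n] [DecidableEq n]

attribute [local instance] Matrix.linftyOpNormedRing Matrix.linftyOpNormedAlgebra

theorem hasDerivAt_exp_neg_smul (A : Matrix n n ℝ) (t : ℝ) :
    HasDerivAt (fun t : ℝ => NormedSpace.exp (-(t • A))) (-(NormedSpace.exp (-(t • A)) * A)) t := by
  have h := hasDerivAt_exp_smul_const (𝕂 := ℝ) (-A) t
  simp only [smul_neg, mul_neg] at h
  exact h

theorem hasDerivAt_exp_neg_smul' (A : Matrix n n ℝ) (t : ℝ) :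
    HasDerivAt (fun t : ℝ => NormedSpace.exp (-(t • A))) (-(A * NormedSpace.exp (-(t • A)))) t := by
  have h := hasDerivAt_exp_smul_const' (𝕂 := ℝ) (-A) t
  simp only [smul_neg, neg_mul] at h
  exact h

theorem transpose_exp_neg_smul (A : Matrix n n ℝ) (t : ℝ) :
    (NormedSpace.exp (-(t • A)))ᵀ = NormedSpace.exp (-(t • Aᵀ)) := by
  rw [← Matrix.exp_transpose]; simp

theorem hasDerivAt_exp_conj (A C : Matrix n n ℝ) (t : ℝ) :
    HasDerivAt (fun t : ℝ => NormedSpace.exp (-(t • A)) * C * (NormedSpace.exp (-(t • A)))ᵀ)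
      (-(NormedSpace.exp (-(t • A)) * (A * C + C * Aᵀ) * (NormedSpace.exp (-(t • A)))ᵀ)) t := by
  simp only [transpose_exp_neg_smul]
  have h := ((hasDerivAt_exp_neg_smul A t).mul_const C).mul (hasDerivAt_exp_neg_smul' Aᵀ t)
  have e : -(NormedSpace.exp (-(t • A)) * (A * C + C * Aᵀ) * NormedSpace.exp (-(t • Aᵀ))) =
      -(NormedSpace.exp (-(t • A)) * A) * C * NormedSpace.exp (-(t • Aᵀ)) +
        NormedSpace.exp (-(t • A)) * C * -(Aᵀ * NormedSpace.exp (-(t • Aᵀ))) := by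
    noncomm_ring
  rw [e]
  exact h

theorem hasDerivAt_exp_conj_apply (A C : Matrix n n ℝ) (a b : n) (t : ℝ) :
    HasDerivAt
      (fun t : ℝ => (NormedSpace.exp (-(t • A)) * C * (NormedSpace.exp (-(t • A)))ᵀ) a b)
      (-(NormedSpace.exp (-(t • A)) * (A * C + C * Aᵀ) * (NormedSpace.exp (-(t • A)))ᵀ) a b) t := by
  have h := hasDerivAt_pi.1 (hasDerivAt_pi.1 (hasDerivAt_exp_conj A C t) a) b
  simpa using h

theorem continuous_exp_conj_apply (A C : Matrix n n ℝ) (a b : n) :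
    Continuous
      (fun t : ℝ => (NormedSpace.exp (-(t • A)) * C * (NormedSpace.exp (-(t • A)))ᵀ) a b) :=
  continuous_iff_continuousAt.2 fun t => (hasDerivAt_exp_conj_apply A C a b t).continuousAt

/-- Fundamental theorem of calculus for e^{-tA} C e^{-tAᵀ}; it trades the time integral defining the
noise covariance for an algebraic expression. -/
theorem integral_exp_conj_apply (A C : Matrix n n ℝ) (a b : n) (t : ℝ) :
    ∫ s in (0 : ℝ)..t,
      (NormedSpace.exp (-(s • A)) * (A * C + C * Aᵀ) * (NormedSpace.exp (-(s • A)))ᵀ) a b =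
      C a b - (NormedSpace.exp (-(t • A)) * C * (NormedSpace.exp (-(t • A)))ᵀ) a b := by
  have h := intervalIntegral.integral_eq_sub_of_hasDerivAt (a := 0) (b := t)
    (fun s _ => hasDerivAt_exp_conj_apply A C a b s)
    ((continuous_exp_conj_apply A (A * C + C * Aᵀ) a b).neg.intervalIntegrable _ _)
  rw [intervalIntegral.integral_neg] at h
  simp only [zero_smul, neg_zero, NormedSpace.exp_zero, one_mul, transpose_one, mul_one] at h
  linarith

/-- All solutions of `x' = -A x` tend to zero. -/
def IsStable (A : Matrix n n ℝ) : Prop :=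
  Tendsto (fun t : ℝ => NormedSpace.exp (-(t • A))) atTop (𝓝 0)

theorem IsStable.tendsto_conj {A : Matrix n n ℝ} (hA : IsStable A) (C : Matrix n n ℝ) :
    Tendsto (fun t : ℝ => NormedSpace.exp (-(t • A)) * C * (NormedSpace.exp (-(t • A)))ᵀ) atTop
      (𝓝 0) := by
  have h2 : Tendsto (fun t : ℝ => (NormedSpace.exp (-(t • A)))ᵀ) atTop (𝓝 0) := by
    have := ((continuous_id (X := Matrix n n ℝ)).matrix_transpose.tendsto 0).comp hA
    rw [id, transpose_zero] at this
    exact this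
  simpa using (hA.mul_const C).mul h2

/-- The Lyapunov operator `C ↦ A C + C Aᵀ`. -/
def lyapunovMap (A : Matrix n n ℝ) : Matrix n n ℝ →ₗ[ℝ] Matrix n n ℝ :=
  LinearMap.mulLeft ℝ A + LinearMap.mulRight ℝ Aᵀ

@[simp]
theorem lyapunovMap_apply (A C : Matrix n n ℝ) : lyapunovMap A C = A * C + C * Aᵀ := rfl

/-- If AC + CAᵀ = 0, then e^{-tA} C e^{-tAᵀ} is constant in t; stability sends it to 0, so C = 0. -/
theorem IsStable.lyapunovMap_injective {A : Matrix n n ℝ} (hA : IsStable A) :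
    Function.Injective (lyapunovMap A) := by
  rw [injective_iff_map_eq_zero]
  intro C hC
  rw [lyapunovMap_apply] at hC
  have hc : ∀ t : ℝ, NormedSpace.exp (-(t • A)) * C * (NormedSpace.exp (-(t • A)))ᵀ = C := by
    intro t
    ext a b
    have h := integral_exp_conj_apply A C a b t
    rw [hC] at h
    simp only [mul_zero, zero_mul, Matrix.zero_apply, intervalIntegral.integral_zero] at h
    linarith
  have h := hA.tendsto_conj C
  simp only [hc] at h
  exact tendsto_nhds_unique tendsto_const_nhds h

/-- The solution `C` of the Lyapunov equation `A C + C Aᵀ = D` for a stable matrix `A`. -/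
noncomputable def lyapunovSolution {A : Matrix n n ℝ} (hA : IsStable A) : Matrix n n ℝ →ₗ[ℝ] Matrix n n ℝ :=
  (LinearEquiv.ofInjectiveEndo (lyapunovMap A) hA.lyapunovMap_injective).symm

theorem lyapunovSolution_spec {A : Matrix n n ℝ} (hA : IsStable A) (D : Matrix n n ℝ) :
    A * lyapunovSolution hA D + lyapunovSolution hA D * Aᵀ = D :=
  (LinearEquiv.ofInjectiveEndo (lyapunovMap A) hA.lyapunovMap_injective).apply_symm_apply D

theorem eq_lyapunovSolution {A : Matrix n n ℝ} (hA : IsStable A) {C D : Matrix n n ℝ}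
    (h : A * C + C * Aᵀ = D) : C = lyapunovSolution hA D :=
  hA.lyapunovMap_injective (by simp only [lyapunovMap_apply, lyapunovSolution_spec, h])

theorem transpose_lyapunovSolution {A : Matrix n n ℝ} (hA : IsStable A) (D : Matrix n n ℝ) :
    (lyapunovSolution hA D)ᵀ = lyapunovSolution hA Dᵀ := by
  apply eq_lyapunovSolution
  have h := congrArg transpose (lyapunovSolution_spec hA D)
  simp only [transpose_add, transpose_mul, transpose_transpose] at h
  rw [← h, add_comm]

theorem posSemidef_of_integral {m : Type*} [Fintype m] {f : ℝ → Matrix m m ℝ} {t : ℝ} (ht : 0 ≤ t)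
    (hc : ∀ a b, Continuous fun s => f s a b) (hf : ∀ s, (f s).PosSemidef) :
    (Matrix.of fun a b => ∫ s in (0 : ℝ)..t, f s a b).PosSemidef := by
  refine Matrix.PosSemidef.of_dotProduct_mulVec_nonneg ?_ fun x => ?_
  · ext a b
    simp only [conjTranspose_apply, of_apply, star_trivial]
    congr 1
    ext s
    simpa using (hf s).isHermitian.apply a b
  · have key : star x ⬝ᵥ (Matrix.of fun a b => ∫ s in (0 : ℝ)..t, f s a b) *ᵥ x =
        ∫ s in (0 : ℝ)..t, star x ⬝ᵥ (f s) *ᵥ x := by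
      simp only [dotProduct, mulVec, of_apply]
      rw [intervalIntegral.integral_finsetSum]
      · refine Finset.sum_congr rfl fun a _ => ?_
        rw [intervalIntegral.integral_const_mul, intervalIntegral.integral_finsetSum]
        · simp only [intervalIntegral.integral_mul_const]
        · exact fun b _ => ((hc a b).mul continuous_const).intervalIntegrable _ _
      · exact fun a _ => (continuous_const.mul (continuous_finsetSum _ fun b _ =>
          (hc a b).mul continuous_const)).intervalIntegrable _ _
    rw [key]
    exact intervalIntegral.integral_nonneg ht fun s _ => (hf s).dotProduct_mulVec_nonneg x

theorem posSemidef_exp_conj (A : Matrix n n ℝ) {D : Matrix n n ℝ} (hD : D.PosSemidef) (t : ℝ) :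
    (NormedSpace.exp (-(t • A)) * D * (NormedSpace.exp (-(t • A)))ᵀ).PosSemidef := by
  simpa using hD.mul_mul_conjTranspose_same (NormedSpace.exp (-(t • A)))

theorem integral_exp_conj_eq {A : Matrix n n ℝ} (hA : IsStable A) (D : Matrix n n ℝ) (t : ℝ) :
    (Matrix.of fun a b => ∫ s in (0 : ℝ)..t,
      (NormedSpace.exp (-(s • A)) * D * (NormedSpace.exp (-(s • A)))ᵀ) a b) =
      lyapunovSolution hA D -
        NormedSpace.exp (-(t • A)) * lyapunovSolution hA D * (NormedSpace.exp (-(t • A)))ᵀ := by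
  ext a b
  have h := integral_exp_conj_apply A (lyapunovSolution hA D) a b t
  rw [lyapunovSolution_spec] at h
  simp [h]

/-- The solution is the limit as t → ∞ of ∫₀ᵗ e^{-sA} D e^{-sAᵀ} ds, an integral of positive
semidefinite matrices. -/
theorem posSemidef_lyapunovSolution {A : Matrix n n ℝ} (hA : IsStable A) {D : Matrix n n ℝ}
    (hD : D.PosSemidef) : (lyapunovSolution hA D).PosSemidef := by
  refine Matrix.PosSemidef.of_dotProduct_mulVec_nonneg ?_ fun x => ?_
  · have h := transpose_lyapunovSolution hA D
    rw [show Dᵀ = D by simpa using hD.isHermitian.eq] at h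
    simpa [IsHermitian] using h
  · have hlim : Tendsto (fun t : ℝ => star x ⬝ᵥ (lyapunovSolution hA D -
        NormedSpace.exp (-(t • A)) * lyapunovSolution hA D * (NormedSpace.exp (-(t • A)))ᵀ) *ᵥ x)
        atTop (𝓝 (star x ⬝ᵥ lyapunovSolution hA D *ᵥ x)) := by
      have h1 := (hA.tendsto_conj (lyapunovSolution hA D)).const_sub (lyapunovSolution hA D)
      have hcont : Continuous fun M : Matrix n n ℝ => star x ⬝ᵥ M *ᵥ x := by fun_prop
      have h2 := (hcont.tendsto _).comp h1
      rw [sub_zero] at h2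
      exact h2
    refine ge_of_tendsto hlim ?_
    filter_upwards [eventually_ge_atTop 0] with t ht
    rw [← integral_exp_conj_eq hA D t]
    exact (posSemidef_of_integral ht (fun a b => continuous_exp_conj_apply A D a b)
      fun s => posSemidef_exp_conj A hD s).dotProduct_mulVec_nonneg x

/-- Lyapunov's criterion for stability. -/
theorem isStable_of_quadratic {A P : Matrix n n ℝ} {p q d : ℝ} (hp : 0 < p) (hq : 0 < q)
    (hd : 0 < d) (hP : ∀ x, p * (x ⬝ᵥ x) ≤ x ⬝ᵥ P *ᵥ x) (hP' : ∀ x, x ⬝ᵥ P *ᵥ x ≤ q * (x ⬝ᵥ x))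
    (hD : ∀ x, d * (x ⬝ᵥ x) ≤ x ⬝ᵥ (Aᵀ * P + P * A) *ᵥ x) : IsStable A := by
  set E : ℝ → Matrix n n ℝ := fun t => NormedSpace.exp (-(t • A)) with hE
  have hET : ∀ t, (E t)ᵀ = NormedSpace.exp (-(t • Aᵀ)) := transpose_exp_neg_smul A
  have hquad : ∀ (M : Matrix n n ℝ) (x : n → ℝ) (t : ℝ),
      x ⬝ᵥ ((E t)ᵀ * M * E t) *ᵥ x = (E t *ᵥ x) ⬝ᵥ M *ᵥ (E t *ᵥ x) := by
    intro M x t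
    rw [← mulVec_mulVec, ← mulVec_mulVec, dotProduct_mulVec, vecMul_transpose]
  have hder : ∀ (x : n → ℝ) (t : ℝ), HasDerivAt
      (fun t => Real.exp (d / q * t) * (x ⬝ᵥ ((E t)ᵀ * P * E t) *ᵥ x))
      (Real.exp (d / q * t) * (d / q * (x ⬝ᵥ ((E t)ᵀ * P * E t) *ᵥ x) -
        x ⬝ᵥ ((E t)ᵀ * (Aᵀ * P + P * A) * E t) *ᵥ x)) t := by
    intro x t
    have h0 : HasDerivAt (fun t => (E t)ᵀ * P * E t)
        (-((E t)ᵀ * (Aᵀ * P + P * A) * E t)) t := by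
      have h := hasDerivAt_exp_conj Aᵀ P t
      simp only [← hET, transpose_transpose] at h
      exact h
    let ℓ : Matrix n n ℝ →ₗ[ℝ] ℝ :=
      { toFun := fun M => x ⬝ᵥ M *ᵥ x
        map_add' := fun M M' => by simp [add_mulVec]
        map_smul' := fun c M => by simp [smul_mulVec] }
    have h1 : HasDerivAt (fun t => x ⬝ᵥ ((E t)ᵀ * P * E t) *ᵥ x)
        (-(x ⬝ᵥ ((E t)ᵀ * (Aᵀ * P + P * A) * E t) *ᵥ x)) t := by
      have h := (LinearMap.toContinuousLinearMap ℓ).hasFDerivAt.comp_hasDerivAt t h0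
      have h' : ℓ (-((E t)ᵀ * (Aᵀ * P + P * A) * E t)) =
          -(x ⬝ᵥ ((E t)ᵀ * (Aᵀ * P + P * A) * E t) *ᵥ x) := map_neg ℓ _
      rw [← h']
      exact h
    have h2 : HasDerivAt (fun t => Real.exp (d / q * t)) (Real.exp (d / q * t) * (d / q)) t := by
      simpa using ((hasDerivAt_id t).const_mul (d / q)).exp
    refine (h2.mul h1).congr_deriv ?_
    ring
  -- Along the flow the derivative of x·Px is at most -d|x|² ≤ -(d/q) x·Px, so the weight exp(dt/q)
  -- still leaves a decreasing quantity.
  have hanti : ∀ x : n → ℝ, Antitone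
      (fun t => Real.exp (d / q * t) * (x ⬝ᵥ ((E t)ᵀ * P * E t) *ᵥ x)) := by
    intro x
    refine antitone_of_hasDerivAt_nonpos (hder x) fun t => ?_
    refine mul_nonpos_of_nonneg_of_nonpos (Real.exp_pos _).le ?_
    rw [hquad, hquad]
    have h1 := hP' (E t *ᵥ x)
    have h2 := hD (E t *ᵥ x)
    have h3 : d / q * ((E t *ᵥ x) ⬝ᵥ P *ᵥ (E t *ᵥ x)) ≤
        d / q * (q * ((E t *ᵥ x) ⬝ᵥ (E t *ᵥ x))) := by gcongr
    rw [← mul_assoc, div_mul_cancel₀ _ hq.ne'] at h3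
    linarith
  have hbound : ∀ (x : n → ℝ) (t : ℝ), 0 ≤ t →
      (E t *ᵥ x) ⬝ᵥ (E t *ᵥ x) ≤ Real.exp (-(d / q * t)) * ((x ⬝ᵥ P *ᵥ x) / p) := by
    intro x t ht
    have h := hanti x ht
    simp only [hquad] at h
    simp only [hE, zero_smul, neg_zero, NormedSpace.exp_zero, one_mulVec, mul_zero,
      Real.exp_zero, one_mul] at h
    have h1 := hP (E t *ᵥ x)
    rw [Real.exp_neg, mul_div_assoc', le_div_iff₀ hp, inv_mul_eq_div,
      le_div_iff₀ (Real.exp_pos _)]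
    calc _ = Real.exp (d / q * t) * (p * ((E t *ᵥ x) ⬝ᵥ (E t *ᵥ x))) := by ring
      _ ≤ _ := by gcongr
      _ ≤ _ := h
  refine tendsto_pi_nhds.2 fun a => tendsto_pi_nhds.2 fun b => ?_
  have hlim : Tendsto (fun t : ℝ => Real.exp (-(d / q * t)) *
      ((Pi.single b 1 ⬝ᵥ P *ᵥ Pi.single b 1) / p)) atTop (𝓝 0) := by
    have h1 : Tendsto (fun t : ℝ => Real.exp (-(d / q * t))) atTop (𝓝 0) :=
      Real.tendsto_exp_neg_atTop_nhds_zero.comp (tendsto_id.const_mul_atTop (div_pos hd hq))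
    simpa using h1.mul_const ((Pi.single b 1 ⬝ᵥ P *ᵥ Pi.single b 1) / p)
  have hsqlim : Tendsto (fun t => (E t a b) ^ 2) atTop (𝓝 0) := by
    refine tendsto_of_tendsto_of_tendsto_of_le_of_le' tendsto_const_nhds hlim
      (Eventually.of_forall fun t => sq_nonneg _) ?_
    filter_upwards [eventually_ge_atTop 0] with t ht
    refine le_trans ?_ (hbound (Pi.single b 1) t ht)
    have h : (E t a b) ^ 2 = (E t *ᵥ Pi.single b 1) a * (E t *ᵥ Pi.single b 1) a := by
      simp [sq]
    rw [h]
    exact Finset.single_le_sum (f := fun i => (E t *ᵥ Pi.single b 1) i * (E t *ᵥ Pi.single b 1) i)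
      (fun i _ => mul_self_nonneg _) (Finset.mem_univ a)
  have habs : Tendsto (fun t => |E t a b|) atTop (𝓝 0) := by
    have h := hsqlim.sqrt
    simpa [Real.sqrt_sq_eq_abs] using h
  simpa using tendsto_zero_iff_abs_tendsto_zero _ |>.2 habs

end Lyapunov

/-! ### Invariant laws of linear Ornstein–Uhlenbeck processes. -/

section OrnsteinUhlenbeck

open Matrix WithLp

variable {n : Type*} [Fintype n] [DecidableEq n]

theorem charFun_map_toEuclideanCLM (μ : Measure (EuclideanSpace ℝ n)) (M : Matrix n n ℝ)
    (ξ : EuclideanSpace ℝ n) :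
    charFun (μ.map (toEuclideanCLM (𝕜 := ℝ) M)) ξ = charFun μ (toEuclideanCLM (𝕜 := ℝ) Mᵀ ξ) := by
  rw [charFun_apply, charFun_apply, integral_map (by fun_prop) (by fun_prop)]
  congr with x
  rw [real_inner_comm, inner_toEuclideanCLM, inner_toEuclideanCLM, dotProduct_mulVec,
    ← mulVec_transpose, dotProduct_comm]

/-- The law at time `t` of the Ornstein–Uhlenbeck process with drift `-A` and diffusion `D`,
started from `μ`. -/
noncomputable def ouLaw (A D : Matrix n n ℝ) (t : ℝ) (μ : Measure (EuclideanSpace ℝ n)) :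
    Measure (EuclideanSpace ℝ n) :=
  (μ.map (toEuclideanCLM (𝕜 := ℝ) (NormedSpace.exp (-(t • A))))) ∗
    multivariateGaussian 0 (Matrix.of fun a b => ∫ s in (0 : ℝ)..t,
      (NormedSpace.exp (-(s • A)) * D * (NormedSpace.exp (-(s • A)))ᵀ) a b)

theorem charFun_ouLaw {A D : Matrix n n ℝ} (hA : IsStable A) (hD : D.PosSemidef) {t : ℝ}
    (ht : 0 ≤ t) (μ : Measure (EuclideanSpace ℝ n)) [IsProbabilityMeasure μ]
    (ξ : EuclideanSpace ℝ n) :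
    charFun (ouLaw A D t μ) ξ =
      charFun μ (toEuclideanCLM (𝕜 := ℝ) (NormedSpace.exp (-(t • A)))ᵀ ξ) *
      Complex.exp (-(((ξ ⬝ᵥ (lyapunovSolution hA D - NormedSpace.exp (-(t • A)) *
        lyapunovSolution hA D * (NormedSpace.exp (-(t • A)))ᵀ) *ᵥ ξ : ℝ) : ℂ) / 2)) := by
  have hpsd := posSemidef_of_integral ht (fun a b => continuous_exp_conj_apply A D a b)
      fun s => posSemidef_exp_conj A hD s
  have : IsProbabilityMeasure (μ.map (toEuclideanCLM (𝕜 := ℝ) (NormedSpace.exp (-(t • A))))) :=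
    Measure.isProbabilityMeasure_map (by fun_prop)
  rw [ouLaw, charFun_conv, charFun_map_toEuclideanCLM, charFun_multivariateGaussian hpsd,
    integral_exp_conj_eq hA]
  simp

theorem ouLaw_multivariateGaussian {A D : Matrix n n ℝ} (hA : IsStable A) (hD : D.PosSemidef)
    {t : ℝ} (ht : 0 ≤ t) :
    ouLaw A D t (multivariateGaussian 0 (lyapunovSolution hA D)) =
      multivariateGaussian 0 (lyapunovSolution hA D) := by
  have hC := posSemidef_lyapunovSolution hA hD
  have : IsProbabilityMeasure ((multivariateGaussian 0 (lyapunovSolution hA D)).map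
      (toEuclideanCLM (𝕜 := ℝ) (NormedSpace.exp (-(t • A))))) :=
    Measure.isProbabilityMeasure_map (by fun_prop)
  have : IsFiniteMeasure (ouLaw A D t (multivariateGaussian 0 (lyapunovSolution hA D))) := by
    unfold ouLaw; infer_instance
  refine Measure.ext_of_charFun (funext fun ξ => ?_)
  rw [charFun_ouLaw hA hD ht, charFun_multivariateGaussian hC, charFun_multivariateGaussian hC,
    ← Complex.exp_add]
  congr 1
  have h : (toEuclideanCLM (𝕜 := ℝ) (NormedSpace.exp (-(t • A)))ᵀ ξ).ofLp ⬝ᵥ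
      lyapunovSolution hA D *ᵥ (toEuclideanCLM (𝕜 := ℝ) (NormedSpace.exp (-(t • A)))ᵀ ξ).ofLp =
      ξ.ofLp ⬝ᵥ (NormedSpace.exp (-(t • A)) * lyapunovSolution hA D *
        (NormedSpace.exp (-(t • A)))ᵀ) *ᵥ ξ.ofLp := by
    rw [ofLp_toEuclideanCLM, ← mulVec_mulVec, ← mulVec_mulVec, dotProduct_mulVec ξ.ofLp,
      mulVec_transpose]
  rw [h, sub_mulVec, dotProduct_sub]
  push_cast
  simp only [inner_zero_right, Complex.ofReal_zero, zero_mul]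
  ring

/-- Invariance equates the characteristic function of μ at ξ with its value at e^{-tAᵀ}ξ times a
Gaussian factor. As t → ∞ the first factor tends to its value 1 at the origin and the second to the
Gaussian of covariance C; no moment assumption on μ is needed. -/
theorem eq_multivariateGaussian_of_ouLaw {A D : Matrix n n ℝ} (hA : IsStable A)
    (hD : D.PosSemidef) (μ : Measure (EuclideanSpace ℝ n)) [IsProbabilityMeasure μ]
    (h : ∀ t : ℝ, 0 ≤ t → ouLaw A D t μ = μ) :
    μ = multivariateGaussian 0 (lyapunovSolution hA D) := by
  refine Measure.ext_of_charFun (funext fun ξ => ?_)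
  rw [charFun_multivariateGaussian (posSemidef_lyapunovSolution hA hD)]
  have hev : ∀ᶠ t : ℝ in atTop, charFun μ ξ =
      charFun μ (toEuclideanCLM (𝕜 := ℝ) (NormedSpace.exp (-(t • A)))ᵀ ξ) *
      Complex.exp (-(((ξ ⬝ᵥ (lyapunovSolution hA D - NormedSpace.exp (-(t • A)) *
        lyapunovSolution hA D * (NormedSpace.exp (-(t • A)))ᵀ) *ᵥ ξ : ℝ) : ℂ) / 2)) := by
    filter_upwards [eventually_ge_atTop 0] with t ht
    rw [← charFun_ouLaw hA hD ht, h t ht]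
  have h1 : Tendsto (fun t : ℝ =>
      charFun μ (toEuclideanCLM (𝕜 := ℝ) (NormedSpace.exp (-(t • A)))ᵀ ξ)) atTop (𝓝 1) := by
    have hc : Continuous fun M : Matrix n n ℝ =>
        charFun μ (toEuclideanCLM (𝕜 := ℝ) Mᵀ ξ) := by
      refine continuous_charFun.comp ?_
      change Continuous fun M : Matrix n n ℝ => toLp 2 (Mᵀ *ᵥ ξ.ofLp)
      fun_prop
    have := (hc.tendsto 0).comp hA
    have h0 : charFun μ (toEuclideanCLM (𝕜 := ℝ) (0 : Matrix n n ℝ)ᵀ ξ) = 1 := by simp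
    rw [h0] at this
    exact this
  have h2 : Tendsto (fun t : ℝ =>
      Complex.exp (-(((ξ ⬝ᵥ (lyapunovSolution hA D - NormedSpace.exp (-(t • A)) *
        lyapunovSolution hA D * (NormedSpace.exp (-(t • A)))ᵀ) *ᵥ ξ : ℝ) : ℂ) / 2))) atTop
      (𝓝 (Complex.exp (-(((ξ ⬝ᵥ (lyapunovSolution hA D) *ᵥ ξ : ℝ) : ℂ) / 2)))) := by
    have hc : Continuous fun M : Matrix n n ℝ =>
        Complex.exp (-(((ξ ⬝ᵥ (lyapunovSolution hA D - M) *ᵥ ξ : ℝ) : ℂ) / 2)) := by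
      fun_prop
    have := (hc.tendsto 0).comp (hA.tendsto_conj (lyapunovSolution hA D))
    rw [sub_zero] at this
    exact this
  have h3 := (h1.mul h2).congr' (hev.mono fun t ht => ht.symm)
  rw [tendsto_nhds_unique tendsto_const_nhds h3]
  simp

theorem integrable_mul_multivariateGaussian (S : Matrix n n ℝ) (a b : n) :
    Integrable (fun x : EuclideanSpace ℝ n => x a * x b) (multivariateGaussian 0 S) := by
  have h : ∀ i : n, MemLp (fun x : EuclideanSpace ℝ n => x i) 2 (multivariateGaussian 0 S) :=
    fun i => (EuclideanSpace.proj (𝕜 := ℝ) i).comp_memLp'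
      (IsGaussian.memLp_two_id (μ := multivariateGaussian 0 S))
  exact (h a).integrable_mul (h b)

theorem integral_mul_multivariateGaussian {S : Matrix n n ℝ} (hS : S.PosSemidef) (a b : n) :
    ∫ x : EuclideanSpace ℝ n, x a * x b ∂(multivariateGaussian 0 S) = S a b := by
  have h : ∀ i : n, MemLp (fun x : EuclideanSpace ℝ n => x i) 2 (multivariateGaussian 0 S) :=
    fun i => (EuclideanSpace.proj (𝕜 := ℝ) i).comp_memLp'
      (IsGaussian.memLp_two_id (μ := multivariateGaussian 0 S))
  have h0 : ∀ i : n, ∫ x : EuclideanSpace ℝ n, x i ∂(multivariateGaussian 0 S) = 0 := by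
    intro i
    have := (EuclideanSpace.proj (𝕜 := ℝ) i).integral_comp_id_comm
      (IsGaussian.integrable_id (μ := multivariateGaussian 0 S))
    rw [integral_id_multivariateGaussian, map_zero] at this
    exact this
  have hc := covariance_eval_multivariateGaussian (μ := 0) hS a b
  rw [covariance_eq_sub (h a) (h b), h0, h0, mul_zero, sub_zero] at hc
  exact hc

end OrnsteinUhlenbeck

/-! ### Cauchy–Schwarz and Schur bounds for matrices. -/

section MatrixBounds

open Matrix

theorem dotProduct_self_nonneg' {m : Type*} [Fintype m] (v : m → ℝ) : 0 ≤ v ⬝ᵥ v :=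
  Finset.sum_nonneg fun i _ => mul_self_nonneg (v i)

theorem abs_dotProduct_le_sqrt_mul_sqrt {m : Type*} [Fintype m] (u v : m → ℝ) :
    |u ⬝ᵥ v| ≤ √(u ⬝ᵥ u) * √(v ⬝ᵥ v) := by
  rw [← Real.sqrt_mul (dotProduct_self_nonneg' u)]
  refine Real.abs_le_sqrt ?_
  have h := Finset.sum_mul_sq_le_sq_mul_sq Finset.univ u v
  simpa [dotProduct, sq] using h

/-- The Schur test. -/
theorem mulVec_dotProduct_mulVec_le {m : Type*} [Fintype m] {M : Matrix m m ℝ} {K : ℝ}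
    (hrow : ∀ k, ∑ l, |M k l| ≤ K) (hcol : ∀ l, ∑ k, |M k l| ≤ K) (v : m → ℝ) :
    (M *ᵥ v) ⬝ᵥ (M *ᵥ v) ≤ K ^ 2 * (v ⬝ᵥ v) := by
  have h1 : ∀ k, (M *ᵥ v) k * (M *ᵥ v) k ≤ K * ∑ l, |M k l| * (v l * v l) := by
    intro k
    have hcs := Finset.sum_mul_sq_le_sq_mul_sq Finset.univ (fun l => √|M k l|)
      (fun l => √|M k l| * |v l|)
    have hs : ∀ l, √|M k l| ^ 2 = |M k l| := fun l => Real.sq_sqrt (abs_nonneg _)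
    have e1 : ∀ l, √|M k l| * (√|M k l| * |v l|) = |M k l * v l| := fun l => by
      rw [abs_mul, ← mul_assoc, ← sq, hs]
    have e2 : ∀ l, (√|M k l| * |v l|) ^ 2 = |M k l| * (v l * v l) := fun l => by
      rw [mul_pow, hs, sq_abs, sq]
    simp only [e1, e2, hs] at hcs
    have h0 : 0 ≤ ∑ l, |M k l| * (v l * v l) :=
      Finset.sum_nonneg fun l _ => mul_nonneg (abs_nonneg _) (mul_self_nonneg _)
    calc (M *ᵥ v) k * (M *ᵥ v) k = |∑ l, M k l * v l| ^ 2 := by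
          rw [sq_abs, sq]; rfl
      _ ≤ (∑ l, |M k l * v l|) ^ 2 := by
          gcongr; exact Finset.abs_sum_le_sum_abs _ _
      _ ≤ (∑ l, |M k l|) * ∑ l, |M k l| * (v l * v l) := hcs
      _ ≤ _ := by gcongr; exact hrow k
  calc (M *ᵥ v) ⬝ᵥ (M *ᵥ v) ≤ ∑ k, K * ∑ l, |M k l| * (v l * v l) :=
        Finset.sum_le_sum fun k _ => h1 k
    _ = K * ∑ l, (∑ k, |M k l|) * (v l * v l) := by
        rw [← Finset.mul_sum, Finset.sum_comm]
        simp only [Finset.sum_mul]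
    _ ≤ K * ∑ l, K * (v l * v l) := by
        rcases isEmpty_or_nonempty m with hm | ⟨⟨k⟩⟩
        · simp
        · have hK : 0 ≤ K := (Finset.sum_nonneg fun l _ => abs_nonneg _).trans (hrow k)
          gcongr with l
          · exact mul_self_nonneg _
          · exact hcol l
    _ = K ^ 2 * (v ⬝ᵥ v) := by rw [← Finset.mul_sum, ← mul_assoc, ← sq]; rfl

theorem sqrt_mulVec_le {m : Type*} [Fintype m] {M : Matrix m m ℝ} {K : ℝ} (hK : 0 ≤ K)
    (hrow : ∀ k, ∑ l, |M k l| ≤ K) (hcol : ∀ l, ∑ k, |M k l| ≤ K) (v : m → ℝ) :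
    √((M *ᵥ v) ⬝ᵥ (M *ᵥ v)) ≤ K * √(v ⬝ᵥ v) := by
  have h := Real.sqrt_le_sqrt (mulVec_dotProduct_mulVec_le hrow hcol v)
  rwa [Real.sqrt_mul (sq_nonneg K), Real.sqrt_sq hK] at h

theorem dotProduct_fromBlocks_mulVec {m : Type*} [Fintype m] (A B C D : Matrix m m ℝ)
    (x : m ⊕ m → ℝ) :
    x ⬝ᵥ fromBlocks A B C D *ᵥ x =
      (x ∘ Sum.inl) ⬝ᵥ A *ᵥ (x ∘ Sum.inl) + (x ∘ Sum.inl) ⬝ᵥ B *ᵥ (x ∘ Sum.inr) +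
      ((x ∘ Sum.inr) ⬝ᵥ C *ᵥ (x ∘ Sum.inl) + (x ∘ Sum.inr) ⬝ᵥ D *ᵥ (x ∘ Sum.inr)) := by
  rw [fromBlocks_mulVec]
  simp only [dotProduct, Fintype.sum_sum_type, Sum.elim_inl, Sum.elim_inr, Pi.add_apply,
    Function.comp, mul_add, Finset.sum_add_distrib]

theorem dotProduct_self_sum {m : Type*} [Fintype m] (x : m ⊕ m → ℝ) :
    x ⬝ᵥ x = (x ∘ Sum.inl) ⬝ᵥ (x ∘ Sum.inl) + (x ∘ Sum.inr) ⬝ᵥ (x ∘ Sum.inr) := by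
  simp only [dotProduct, Fintype.sum_sum_type, Function.comp]

/-- For a positive semidefinite matrix, entries are bounded by diagonal entries. -/
theorem abs_dotProduct_mulVec_le {m : Type*} [Fintype m] {S : Matrix m m ℝ}
    (hS : S.PosSemidef) (x y : m → ℝ) :
    |x ⬝ᵥ S *ᵥ y| ≤ √(x ⬝ᵥ S *ᵥ x) * √(y ⬝ᵥ S *ᵥ y) := by
  have hsym : y ⬝ᵥ S *ᵥ x = x ⬝ᵥ S *ᵥ y := by
    have hT : Sᵀ = S := by simpa using hS.isHermitian.eq
    rw [dotProduct_mulVec, ← mulVec_transpose, hT, dotProduct_comm]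
  have hnn : ∀ z : m → ℝ, 0 ≤ z ⬝ᵥ S *ᵥ z := fun z => by
    simpa using hS.dotProduct_mulVec_nonneg z
  rw [← Real.sqrt_mul (hnn x)]
  refine Real.abs_le_sqrt ?_
  have h : ∀ t : ℝ, 0 ≤ (y ⬝ᵥ S *ᵥ y) * (t * t) + (2 * (x ⬝ᵥ S *ᵥ y)) * t + x ⬝ᵥ S *ᵥ x := by
    intro t
    have := hnn (x + t • y)
    simp only [mulVec_add, mulVec_smul, dotProduct_add, add_dotProduct, smul_dotProduct,
      dotProduct_smul, smul_eq_mul, hsym] at this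
    linarith
  have := discrim_le_zero h
  rw [discrim] at this
  nlinarith

end MatrixBounds

/-! ### The adjacency matrix of the path. -/

section Neighbours

open Matrix

/-- The adjacency matrix of the path on `N` sites. -/
def neighbourMatrix (N : ℕ) : Matrix (Fin N) (Fin N) ℝ :=
  Matrix.of fun i j => if (i : ℕ) + 1 = (j : ℕ) ∨ (j : ℕ) + 1 = (i : ℕ) then 1 else 0

/-- Extension of a vector by zero; the site `k` corresponds to the index `k + 1`. -/
def pad {N : ℕ} (v : Fin N → ℝ) (n : ℕ) : ℝ :=
  ∑ j : Fin N, if (j : ℕ) + 1 = n then v j else 0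

@[simp]
theorem pad_zero {N : ℕ} (v : Fin N → ℝ) : pad v 0 = 0 := by simp [pad]

theorem pad_succ {N : ℕ} (v : Fin N → ℝ) {k : ℕ} (hk : k < N) : pad v (k + 1) = v ⟨k, hk⟩ := by
  unfold pad
  rw [Finset.sum_eq_single ⟨k, hk⟩]
  · simp
  · intro b _ hb
    rw [if_neg]
    intro h
    exact hb (Fin.ext (by simpa using h))
  · simp

theorem pad_of_lt {N : ℕ} (v : Fin N → ℝ) {n : ℕ} (hn : N < n) : pad v n = 0 := by
  unfold pad
  exact Finset.sum_eq_zero fun j _ => if_neg (by omega)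

theorem neighbourMatrix_mulVec {N : ℕ} (v : Fin N → ℝ) (k : Fin N) :
    (neighbourMatrix N *ᵥ v) k = pad v k + pad v (k + 2) := by
  simp only [mulVec, dotProduct, neighbourMatrix, of_apply, pad, ← Finset.sum_add_distrib]
  refine Finset.sum_congr rfl fun j _ => ?_
  by_cases h1 : (j : ℕ) + 1 = k
  · rw [if_pos (Or.inr h1), if_pos h1, if_neg (by omega)]; ring
  · by_cases h2 : (j : ℕ) + 1 = k + 2
    · rw [if_pos (Or.inl (by omega)), if_neg h1, if_pos h2]; ring
    · rw [if_neg (by omega), if_neg h1, if_neg h2]; ring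

theorem abs_pad_le {N : ℕ} {v : Fin N → ℝ} {ρ : ℝ} (hρ : 0 ≤ ρ) (h : ∀ k, |v k| ≤ ρ) (n : ℕ) :
    |pad v n| ≤ ρ := by
  rcases n with _ | n
  · simpa
  · by_cases hn : n < N
    · rw [pad_succ v hn]; exact h _
    · rw [pad_of_lt v (by omega)]; simpa

theorem abs_neighbourMatrix_mulVec_le {N : ℕ} {v : Fin N → ℝ} {ρ : ℝ} (hρ : 0 ≤ ρ)
    (h : ∀ k, |v k| ≤ ρ) (k : Fin N) : |(neighbourMatrix N *ᵥ v) k| ≤ 2 * ρ := by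
  rw [neighbourMatrix_mulVec]
  have h1 := abs_pad_le hρ h k
  have h2 := abs_pad_le hρ h (k + 2)
  have h3 := abs_add_le (pad v k) (pad v (k + 2))
  linarith

theorem neighbourMatrix_nonneg {N : ℕ} (k l : Fin N) : 0 ≤ neighbourMatrix N k l := by
  simp only [neighbourMatrix, of_apply]; split_ifs <;> norm_num

theorem sum_neighbourMatrix_le {N : ℕ} (k : Fin N) : ∑ l, neighbourMatrix N k l ≤ 2 := by
  have h := abs_neighbourMatrix_mulVec_le (N := N) (v := 1) (ρ := 1) (by norm_num) (by simp) k
  have e : (neighbourMatrix N *ᵥ 1) k = ∑ l, neighbourMatrix N k l := by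
    simp [mulVec, dotProduct]
  rw [e] at h
  linarith [le_abs_self (∑ l, neighbourMatrix N k l)]

theorem neighbourMatrix_transpose (N : ℕ) : (neighbourMatrix N)ᵀ = neighbourMatrix N := by
  ext i j
  simp only [neighbourMatrix, transpose_apply, of_apply, or_comm]

theorem neighbourMatrix_comm {N : ℕ} (k l : Fin N) :
    neighbourMatrix N k l = neighbourMatrix N l k := congrFun₂ (neighbourMatrix_transpose N) l k

/-- The Schur test for a matrix whose entries are dominated by the adjacency matrix. -/
theorem sqrt_mulVec_le_of_le_neighbour {N : ℕ} {M : Matrix (Fin N) (Fin N) ℝ} {c : ℝ} (hc : 0 ≤ c)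
    (hM : ∀ k l, |M k l| ≤ c * neighbourMatrix N k l) (v : Fin N → ℝ) :
    √((M *ᵥ v) ⬝ᵥ (M *ᵥ v)) ≤ (2 * c) * √(v ⬝ᵥ v) := by
  have hrow : ∀ k, ∑ l, c * neighbourMatrix N k l ≤ 2 * c := fun k => by
    rw [← Finset.mul_sum]
    nlinarith [sum_neighbourMatrix_le k]
  refine sqrt_mulVec_le (by positivity) (fun k => ?_) (fun l => ?_) v
  · exact (Finset.sum_le_sum fun l _ => hM k l).trans (hrow k)
  · refine (Finset.sum_le_sum fun k _ => hM k l).trans ?_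
    simp only [neighbourMatrix_comm _ l]
    exact hrow l

theorem sqrt_neighbourMatrix_mulVec_le {N : ℕ} (v : Fin N → ℝ) :
    √((neighbourMatrix N *ᵥ v) ⬝ᵥ (neighbourMatrix N *ᵥ v)) ≤ 2 * √(v ⬝ᵥ v) := by
  have h := sqrt_mulVec_le_of_le_neighbour (M := neighbourMatrix N) zero_le_one
    (fun k l => by rw [one_mul, abs_of_nonneg (neighbourMatrix_nonneg k l)]) v
  simpa using h

theorem abs_dotProduct_neighbourMatrix_le {N : ℕ} (v : Fin N → ℝ) :
    |v ⬝ᵥ neighbourMatrix N *ᵥ v| ≤ 2 * (v ⬝ᵥ v) := by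
  calc _ ≤ √(v ⬝ᵥ v) * √((neighbourMatrix N *ᵥ v) ⬝ᵥ (neighbourMatrix N *ᵥ v)) :=
        abs_dotProduct_le_sqrt_mul_sqrt _ _
    _ ≤ √(v ⬝ᵥ v) * (2 * √(v ⬝ᵥ v)) := by gcongr; exact sqrt_neighbourMatrix_mulVec_le v
    _ = 2 * (√(v ⬝ᵥ v) * √(v ⬝ᵥ v)) := by ring
    _ = _ := by rw [Real.mul_self_sqrt (dotProduct_self_nonneg' v)]

end Neighbours

/-- Parameters of the chain: coupling frequency, pinning frequency and friction. -/
structure Params where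
  /-- coupling frequency -/
  ω : ℝ
  /-- pinning frequency -/
  γ : ℝ
  /-- friction constant of the reservoirs -/
  lam : ℝ
  ω_pos : 0 < ω
  γ_pos : 0 < γ
  lam_pos : 0 < lam

/-! ### The force matrix and stability of the drift. -/

namespace Params

open Matrix

variable (p : Params) {N : ℕ}

/-- The force matrix of the chain. -/
noncomputable abbrev Φ (N : ℕ) : Matrix (Fin N) (Fin N) ℝ := forceMatrix p.ω p.γ N

theorem Φ_eq (N : ℕ) :
    p.Φ N = (2 * p.ω ^ 2 + p.γ ^ 2) • (1 : Matrix (Fin N) (Fin N) ℝ) -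
      p.ω ^ 2 • neighbourMatrix N := by
  have hω := p.ω_pos.ne'
  ext i j
  simp only [forceMatrix, laplacian, nuSq, neighbourMatrix, Matrix.smul_apply, Matrix.add_apply,
    Matrix.neg_apply, Matrix.sub_apply, of_apply, Matrix.one_apply, smul_eq_mul]
  by_cases hij : i = j
  · subst hij
    simp
    field_simp
  · simp only [hij, if_false]
    split_ifs <;> simp

theorem Φ_transpose (N : ℕ) : (p.Φ N)ᵀ = p.Φ N := by
  rw [Φ_eq]; simp [neighbourMatrix_transpose]

theorem Φ_mulVec (v : Fin N → ℝ) :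
    p.Φ N *ᵥ v = (2 * p.ω ^ 2 + p.γ ^ 2) • v - p.ω ^ 2 • (neighbourMatrix N *ᵥ v) := by
  rw [Φ_eq]; simp [sub_mulVec, smul_mulVec]

theorem Φ_mulVec_apply (v : Fin N → ℝ) (k : Fin N) :
    (p.Φ N *ᵥ v) k = (2 * p.ω ^ 2 + p.γ ^ 2) * v k - p.ω ^ 2 * (pad v k + pad v (k + 2)) := by
  rw [Φ_mulVec, ← neighbourMatrix_mulVec]; simp

theorem Φ_diag (k : Fin N) : p.Φ N k k = 2 * p.ω ^ 2 + p.γ ^ 2 := by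
  rw [Φ_eq]; simp [neighbourMatrix]

theorem le_dotProduct_Φ (v : Fin N → ℝ) : p.γ ^ 2 * (v ⬝ᵥ v) ≤ v ⬝ᵥ p.Φ N *ᵥ v := by
  rw [Φ_mulVec]
  simp only [dotProduct_sub, dotProduct_smul, smul_eq_mul]
  have h := (abs_le.1 (abs_dotProduct_neighbourMatrix_le v)).2
  nlinarith [sq_nonneg p.ω]

theorem dotProduct_Φ_le (v : Fin N → ℝ) :
    v ⬝ᵥ p.Φ N *ᵥ v ≤ (4 * p.ω ^ 2 + p.γ ^ 2) * (v ⬝ᵥ v) := by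
  rw [Φ_mulVec]
  simp only [dotProduct_sub, dotProduct_smul, smul_eq_mul]
  have h := (abs_le.1 (abs_dotProduct_neighbourMatrix_le v)).1
  nlinarith [sq_nonneg p.ω]

theorem Φ_row_le (k : Fin N) : ∑ l, |p.Φ N k l| ≤ 4 * p.ω ^ 2 + p.γ ^ 2 := by
  have h : ∀ l, |p.Φ N k l| ≤ (2 * p.ω ^ 2 + p.γ ^ 2) * (1 : Matrix (Fin N) (Fin N) ℝ) k l +
      p.ω ^ 2 * neighbourMatrix N k l := by
    intro l
    rw [Φ_eq]
    simp only [Matrix.sub_apply, Matrix.smul_apply, smul_eq_mul]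
    refine (abs_sub _ _).trans ?_
    have h1 : (0 : ℝ) ≤ (1 : Matrix (Fin N) (Fin N) ℝ) k l := by
      rw [Matrix.one_apply]; split_ifs <;> norm_num
    rw [abs_of_nonneg (mul_nonneg (by positivity) h1),
      abs_of_nonneg (mul_nonneg (by positivity) (neighbourMatrix_nonneg k l))]
  refine (Finset.sum_le_sum fun l _ => h l).trans ?_
  rw [Finset.sum_add_distrib, ← Finset.mul_sum, ← Finset.mul_sum]
  have h1 : ∑ l, (1 : Matrix (Fin N) (Fin N) ℝ) k l = 1 := by simp [Matrix.one_apply]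
  rw [h1]
  nlinarith [sum_neighbourMatrix_le k, sq_nonneg p.ω]

theorem sqrt_Φ_mulVec_le (v : Fin N → ℝ) :
    √((p.Φ N *ᵥ v) ⬝ᵥ (p.Φ N *ᵥ v)) ≤ (4 * p.ω ^ 2 + p.γ ^ 2) * √(v ⬝ᵥ v) := by
  refine sqrt_mulVec_le (by positivity) p.Φ_row_le (fun l => ?_) v
  have h := p.Φ_row_le l
  rw [← p.Φ_transpose] at h
  exact h

/-- The maximum principle for the force matrix. -/
theorem abs_le_of_abs_Φ_le {v : Fin N → ℝ} {ρ : ℝ} (h : ∀ k, |(p.Φ N *ᵥ v) k| ≤ ρ) (k : Fin N) :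
    |v k| ≤ ρ / p.γ ^ 2 := by
  have hγ := p.γ_pos
  -- At a site m where |v| is largest, the neighbours contribute at most 2ω²|v m|, which leaves γ²|v
  -- m| ≤ ρ.
  obtain ⟨m, -, hm⟩ := Finset.exists_max_image Finset.univ (fun k => |v k|) ⟨k, Finset.mem_univ k⟩
  have hm' : ∀ k, |v k| ≤ |v m| := fun k => hm k (Finset.mem_univ k)
  refine (hm' k).trans ?_
  rw [le_div_iff₀ (by positivity)]
  have h1 := abs_neighbourMatrix_mulVec_le (abs_nonneg (v m)) hm' m
  have h2 := h m
  rw [Φ_mulVec] at h2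
  simp only [Pi.sub_apply, Pi.smul_apply, smul_eq_mul] at h2
  have h3 : |(2 * p.ω ^ 2 + p.γ ^ 2) * v m| ≤
      |(2 * p.ω ^ 2 + p.γ ^ 2) * v m - p.ω ^ 2 * (neighbourMatrix N *ᵥ v) m| +
        |p.ω ^ 2 * (neighbourMatrix N *ᵥ v) m| := by
    have := abs_add_le ((2 * p.ω ^ 2 + p.γ ^ 2) * v m - p.ω ^ 2 * (neighbourMatrix N *ᵥ v) m)
      (p.ω ^ 2 * (neighbourMatrix N *ᵥ v) m)
    rwa [sub_add_cancel] at this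
  rw [abs_mul, abs_mul (p.ω ^ 2), abs_of_pos (by positivity : 0 < 2 * p.ω ^ 2 + p.γ ^ 2),
    abs_of_nonneg (sq_nonneg p.ω)] at h3
  nlinarith [sq_nonneg p.ω]

/-- The drift matrix of the chain. -/
noncomputable abbrev drift (N : ℕ) : Matrix (Fin N ⊕ Fin N) (Fin N ⊕ Fin N) ℝ :=
  driftMatrix p.ω p.γ p.lam N

theorem drift_transpose (N : ℕ) :
    (p.drift N)ᵀ = fromBlocks 0 (p.Φ N) (-1) (p.lam • (1 : Matrix (Fin N) (Fin N) ℝ)) := by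
  simp [drift, driftMatrix, fromBlocks_transpose, p.Φ_transpose]

/-- The energy alone dissipates only in the momenta, so its Lyapunov form is supplemented by the
cross term 2δ q·p. -/
theorem isStable_drift (N : ℕ) : IsStable (p.drift N) := by
  have hω := p.ω_pos
  have hγ := p.γ_pos
  have hlam := p.lam_pos
  -- The bound δ ≤ γ/2 keeps the cross term below half of γ²|q|² + |p|²; the bound δ ≤ λ/2 leaves
  -- dissipation at least λ|p|².
  set δ : ℝ := min (p.lam / 2) (p.γ / 2) with hδ
  have hδ0 : 0 < δ := by positivity
  have hδ1 : δ ≤ p.lam / 2 := min_le_left _ _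
  have hδ2 : δ ≤ p.γ / 2 := min_le_right _ _
  have hr : δ / p.γ ≤ 1 / 2 := by rw [div_le_iff₀ hγ]; linarith
  have hr0 : 0 < δ / p.γ := by positivity
  -- The extra λδ in the position block makes the off-diagonal blocks of AᵀP + PA vanish.
  set P : Matrix (Fin N ⊕ Fin N) (Fin N ⊕ Fin N) ℝ :=
    fromBlocks (p.Φ N + (p.lam * δ) • 1) (δ • 1) (δ • 1) 1 with hP
  have hquad : ∀ x : Fin N ⊕ Fin N → ℝ, x ⬝ᵥ P *ᵥ x =
      (x ∘ Sum.inl) ⬝ᵥ p.Φ N *ᵥ (x ∘ Sum.inl) + p.lam * δ * ((x ∘ Sum.inl) ⬝ᵥ (x ∘ Sum.inl)) +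
      2 * δ * ((x ∘ Sum.inl) ⬝ᵥ (x ∘ Sum.inr)) + (x ∘ Sum.inr) ⬝ᵥ (x ∘ Sum.inr) := by
    intro x
    rw [hP, dotProduct_fromBlocks_mulVec]
    simp only [add_mulVec, smul_mulVec, one_mulVec, dotProduct_add, dotProduct_smul, smul_eq_mul]
    rw [dotProduct_comm (x ∘ Sum.inr) (x ∘ Sum.inl)]
    ring
  have hcross : ∀ q r : Fin N → ℝ, |2 * p.γ * (q ⬝ᵥ r)| ≤ p.γ ^ 2 * (q ⬝ᵥ q) + r ⬝ᵥ r := by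
    intro q r
    have h1 := dotProduct_self_nonneg' (p.γ • q + r)
    have h2 := dotProduct_self_nonneg' (p.γ • q - r)
    simp only [add_dotProduct, dotProduct_add, sub_dotProduct, dotProduct_sub, smul_dotProduct,
      dotProduct_smul, smul_eq_mul, dotProduct_comm r q] at h1 h2
    rw [abs_le]
    constructor <;> nlinarith
  have hsplit : ∀ q r : Fin N → ℝ, |2 * δ * (q ⬝ᵥ r)| ≤ (p.γ ^ 2 * (q ⬝ᵥ q) + r ⬝ᵥ r) / 2 := by
    intro q r
    have e : 2 * δ * (q ⬝ᵥ r) = (δ / p.γ) * (2 * p.γ * (q ⬝ᵥ r)) := by field_simp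
    rw [e, abs_mul, abs_of_pos hr0]
    nlinarith [hcross q r, abs_nonneg (2 * p.γ * (q ⬝ᵥ r))]
  have hD : (p.drift N)ᵀ * P + P * p.drift N =
      fromBlocks ((2 * δ) • p.Φ N) 0 0 ((2 * p.lam - 2 * δ) • 1) := by
    rw [p.drift_transpose, hP, drift, driftMatrix, fromBlocks_multiply, fromBlocks_multiply,
      fromBlocks_add]
    congr 1
    · simp [two_mul, add_smul]
    · simp; module
    · simp; module
    · simp; module
  have hsq := fun v : Fin N → ℝ => dotProduct_self_nonneg' v
  refine isStable_of_quadratic (P := P) (p := min (p.γ ^ 2 / 2) (1 / 2))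
    (q := 4 * p.ω ^ 2 + p.γ ^ 2 + p.lam * δ + p.γ ^ 2 / 2 + 3 / 2)
    (d := min (2 * δ * p.γ ^ 2) p.lam) (by positivity) (by positivity) (by positivity) ?_ ?_ ?_
  · intro x
    rw [hquad, dotProduct_self_sum x]
    have h1 := p.le_dotProduct_Φ (x ∘ Sum.inl)
    have h2 := (abs_le.1 (hsplit (x ∘ Sum.inl) (x ∘ Sum.inr))).1
    have h3 : min (p.γ ^ 2 / 2) (1 / 2) * ((x ∘ Sum.inl) ⬝ᵥ (x ∘ Sum.inl)) ≤
        p.γ ^ 2 / 2 * ((x ∘ Sum.inl) ⬝ᵥ (x ∘ Sum.inl)) :=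
      mul_le_mul_of_nonneg_right (min_le_left _ _) (hsq _)
    have h4 : min (p.γ ^ 2 / 2) (1 / 2) * ((x ∘ Sum.inr) ⬝ᵥ (x ∘ Sum.inr)) ≤
        1 / 2 * ((x ∘ Sum.inr) ⬝ᵥ (x ∘ Sum.inr)) :=
      mul_le_mul_of_nonneg_right (min_le_right _ _) (hsq _)
    have h5 := mul_nonneg (mul_pos hlam hδ0).le (hsq (x ∘ Sum.inl))
    linarith
  · intro x
    rw [hquad, dotProduct_self_sum x]
    have h1 := p.dotProduct_Φ_le (x ∘ Sum.inl)
    have h2 := (abs_le.1 (hsplit (x ∘ Sum.inl) (x ∘ Sum.inr))).2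
    have h5 := mul_nonneg (mul_pos hlam hδ0).le (hsq (x ∘ Sum.inr))
    have h6 := mul_nonneg (sq_nonneg p.ω) (hsq (x ∘ Sum.inr))
    have h7 := mul_nonneg (sq_nonneg p.γ) (hsq (x ∘ Sum.inr))
    have h8 := hsq (x ∘ Sum.inl)
    linarith
  · intro x
    rw [hD, dotProduct_fromBlocks_mulVec, dotProduct_self_sum x]
    simp only [zero_mulVec, dotProduct_zero, smul_mulVec, one_mulVec, dotProduct_smul,
      smul_eq_mul, add_zero, zero_add, mul_add]
    have h1 := p.le_dotProduct_Φ (x ∘ Sum.inl)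
    have h3 : min (2 * δ * p.γ ^ 2) p.lam * ((x ∘ Sum.inl) ⬝ᵥ (x ∘ Sum.inl)) ≤
        2 * δ * p.γ ^ 2 * ((x ∘ Sum.inl) ⬝ᵥ (x ∘ Sum.inl)) :=
      mul_le_mul_of_nonneg_right (min_le_left _ _) (hsq _)
    have h4 : min (2 * δ * p.γ ^ 2) p.lam * ((x ∘ Sum.inr) ⬝ᵥ (x ∘ Sum.inr)) ≤
        (2 * p.lam - 2 * δ) * ((x ∘ Sum.inr) ⬝ᵥ (x ∘ Sum.inr)) :=
      mul_le_mul_of_nonneg_right ((min_le_right _ _).trans (by linarith)) (hsq _)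
    have h5 := mul_le_mul_of_nonneg_left h1 (by positivity : 0 ≤ 2 * δ)
    linarith

/-! ### Blocks of the stationary covariance as linear functions of the temperatures. -/

/-- The diffusion matrix `diag(0, 2 λ T)` generated by a matrix `T` of temperatures. -/
noncomputable def source (N : ℕ) :
    Matrix (Fin N) (Fin N) ℝ →ₗ[ℝ] Matrix (Fin N ⊕ Fin N) (Fin N ⊕ Fin N) ℝ where
  toFun T := fromBlocks 0 0 0 ((2 * p.lam) • T)
  map_add' S T := by simp [fromBlocks_add]
  map_smul' c T := by rw [smul_comm, RingHom.id_apply, fromBlocks_smul]; simp only [smul_zero]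

/-- The stationary covariance as a function of the matrix of temperatures. -/
noncomputable def cov (N : ℕ) :
    Matrix (Fin N) (Fin N) ℝ →ₗ[ℝ] Matrix (Fin N ⊕ Fin N) (Fin N ⊕ Fin N) ℝ :=
  lyapunovSolution (p.isStable_drift N) ∘ₗ p.source N

/-- The position-position block of the stationary covariance. -/
noncomputable def U : Matrix (Fin N) (Fin N) ℝ →ₗ[ℝ] Matrix (Fin N) (Fin N) ℝ where
  toFun T := (p.cov N T).toBlocks₁₁
  map_add' S T := by rw [map_add]; rfl
  map_smul' c T := by rw [map_smul]; rfl

/-- The position-momentum block of the stationary covariance. -/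
noncomputable def Z : Matrix (Fin N) (Fin N) ℝ →ₗ[ℝ] Matrix (Fin N) (Fin N) ℝ where
  toFun T := (p.cov N T).toBlocks₁₂
  map_add' S T := by rw [map_add]; rfl
  map_smul' c T := by rw [map_smul]; rfl

/-- The momentum-momentum block of the stationary covariance. -/
noncomputable def V : Matrix (Fin N) (Fin N) ℝ →ₗ[ℝ] Matrix (Fin N) (Fin N) ℝ where
  toFun T := (p.cov N T).toBlocks₂₂
  map_add' S T := by rw [map_add]; rfl
  map_smul' c T := by rw [map_smul]; rfl

theorem lyapunov_blocks (U Z Z' V : Matrix (Fin N) (Fin N) ℝ) :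
    p.drift N * fromBlocks U Z Z' V + fromBlocks U Z Z' V * (p.drift N)ᵀ =
      fromBlocks (-Z' - Z) (-V + U * p.Φ N + p.lam • Z) (p.Φ N * U + p.lam • Z' - V)
        (p.Φ N * Z + Z' * p.Φ N + (2 * p.lam) • V) := by
  rw [drift_transpose, drift, driftMatrix, fromBlocks_multiply, fromBlocks_multiply,
    fromBlocks_add]
  congr 1
  · simp; abel
  · simp; abel
  · simp; abel
  · simp [two_mul, add_smul]; abel

theorem cov_eq_fromBlocks (T : Matrix (Fin N) (Fin N) ℝ) :
    p.cov N T = fromBlocks (p.U T) (p.Z T) (p.cov N T).toBlocks₂₁ (p.V T) :=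
  (fromBlocks_toBlocks _).symm

theorem cov_spec (T : Matrix (Fin N) (Fin N) ℝ) :
    p.drift N * p.cov N T + p.cov N T * (p.drift N)ᵀ = fromBlocks 0 0 0 ((2 * p.lam) • T) :=
  lyapunovSolution_spec (p.isStable_drift N) (p.source N T)

theorem cov_block₂₁ (T : Matrix (Fin N) (Fin N) ℝ) : (p.cov N T).toBlocks₂₁ = -p.Z T := by
  have h := p.cov_spec T
  rw [cov_eq_fromBlocks, lyapunov_blocks, fromBlocks_inj] at h
  have h1 := h.1
  rw [sub_eq_zero] at h1
  rw [← h1, neg_neg]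

theorem V_eq (T : Matrix (Fin N) (Fin N) ℝ) : p.V T = p.U T * p.Φ N + p.lam • p.Z T := by
  have h := p.cov_spec T
  rw [cov_eq_fromBlocks, lyapunov_blocks, fromBlocks_inj] at h
  have h1 := h.2.1
  rw [add_assoc, neg_add_eq_zero] at h1
  exact h1

theorem V_eq' (T : Matrix (Fin N) (Fin N) ℝ) : p.V T = p.Φ N * p.U T - p.lam • p.Z T := by
  have h := p.cov_spec T
  rw [cov_eq_fromBlocks, lyapunov_blocks, fromBlocks_inj, cov_block₂₁] at h
  have h1 := h.2.2.1
  rw [sub_eq_zero] at h1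
  rw [← h1, smul_neg, sub_eq_add_neg]

theorem energy_balance (T : Matrix (Fin N) (Fin N) ℝ) :
    p.Φ N * p.Z T - p.Z T * p.Φ N + (2 * p.lam) • p.V T = (2 * p.lam) • T := by
  have h := p.cov_spec T
  rw [cov_eq_fromBlocks, lyapunov_blocks, fromBlocks_inj, cov_block₂₁] at h
  have h1 := h.2.2.2
  rw [← h1, neg_mul, sub_eq_add_neg]

/-- Explicit covariances are recognised here by checking three block equations. -/
theorem blocks_unique {T U Z V : Matrix (Fin N) (Fin N) ℝ} (h1 : V = U * p.Φ N + p.lam • Z)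
    (h2 : V = p.Φ N * U - p.lam • Z)
    (h3 : p.Φ N * Z - Z * p.Φ N + (2 * p.lam) • V = (2 * p.lam) • T) :
    p.U T = U ∧ p.Z T = Z ∧ p.V T = V := by
  have h : p.cov N T = fromBlocks U Z (-Z) V := by
    symm
    refine eq_lyapunovSolution (p.isStable_drift N) ?_
    rw [lyapunov_blocks]
    change _ = fromBlocks 0 0 0 ((2 * p.lam) • T)
    rw [← h3]
    congr 1
    · simp
    · rw [h1]; abel
    · rw [h2, smul_neg]; abel
    · rw [neg_mul, sub_eq_add_neg]
  refine ⟨?_, ?_, ?_⟩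
  · change (p.cov N T).toBlocks₁₁ = U
    rw [h, toBlocks_fromBlocks₁₁]
  · change (p.cov N T).toBlocks₁₂ = Z
    rw [h, toBlocks_fromBlocks₁₂]
  · change (p.cov N T).toBlocks₂₂ = V
    rw [h, toBlocks_fromBlocks₂₂]

theorem cov_transpose (T : Matrix (Fin N) (Fin N) ℝ) : (p.cov N T)ᵀ = p.cov N Tᵀ := by
  change (lyapunovSolution (p.isStable_drift N) (p.source N T))ᵀ =
    lyapunovSolution (p.isStable_drift N) (p.source N Tᵀ)
  rw [transpose_lyapunovSolution]
  congr 1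
  simp [source, fromBlocks_transpose]

theorem U_transpose (T : Matrix (Fin N) (Fin N) ℝ) : (p.U T)ᵀ = p.U Tᵀ := by
  ext i j
  exact congrFun₂ (p.cov_transpose T) (Sum.inl i) (Sum.inl j)

theorem Z_transpose (T : Matrix (Fin N) (Fin N) ℝ) : (p.Z T)ᵀ = -p.Z Tᵀ := by
  rw [← cov_block₂₁]
  ext i j
  exact congrFun₂ (p.cov_transpose T) (Sum.inr i) (Sum.inl j)

theorem Z_diagonal_comm (T : Fin N → ℝ) (i j : Fin N) :
    p.Z (diagonal T) i j = -p.Z (diagonal T) j i := by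
  have h := p.Z_transpose (diagonal T)
  rw [diagonal_transpose] at h
  simpa using congrFun₂ h j i

theorem U_diagonal_comm (T : Fin N → ℝ) (i j : Fin N) :
    p.U (diagonal T) i j = p.U (diagonal T) j i := by
  have h := p.U_transpose (diagonal T)
  rw [diagonal_transpose] at h
  exact congrFun₂ h j i

theorem source_posSemidef {T : Matrix (Fin N) (Fin N) ℝ} (hT : T.PosSemidef) :
    (p.source N T).PosSemidef := by
  have hTt : Tᵀ = T := by simpa using hT.isHermitian.eq
  refine PosSemidef.of_dotProduct_mulVec_nonneg ?_ fun x => ?_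
  · rw [IsHermitian, conjTranspose_eq_transpose_of_trivial]
    simp [source, fromBlocks_transpose, hTt]
  · change 0 ≤ star x ⬝ᵥ fromBlocks 0 0 0 ((2 * p.lam) • T) *ᵥ x
    rw [star_trivial, dotProduct_fromBlocks_mulVec]
    have h := hT.dotProduct_mulVec_nonneg (x ∘ Sum.inr)
    rw [star_trivial] at h
    simp only [zero_mulVec, dotProduct_zero, smul_mulVec, dotProduct_smul, smul_eq_mul, zero_add]
    have := p.lam_pos
    positivity

theorem cov_posSemidef {T : Matrix (Fin N) (Fin N) ℝ} (hT : T.PosSemidef) :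
    (p.cov N T).PosSemidef :=
  posSemidef_lyapunovSolution (p.isStable_drift N) (p.source_posSemidef hT)

theorem U_posSemidef {T : Matrix (Fin N) (Fin N) ℝ} (hT : T.PosSemidef) : (p.U T).PosSemidef :=
  (p.cov_posSemidef hT).submatrix Sum.inl

theorem V_posSemidef {T : Matrix (Fin N) (Fin N) ℝ} (hT : T.PosSemidef) : (p.V T).PosSemidef :=
  (p.cov_posSemidef hT).submatrix Sum.inr

theorem U_apply_le {S T : Matrix (Fin N) (Fin N) ℝ} (h : (T - S).PosSemidef) (i : Fin N) :
    p.U S i i ≤ p.U T i i := by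
  have := (p.U_posSemidef h).diag_nonneg (i := i)
  rw [map_sub, Matrix.sub_apply] at this
  linarith

theorem V_apply_le {S T : Matrix (Fin N) (Fin N) ℝ} (h : (T - S).PosSemidef) (i : Fin N) :
    p.V S i i ≤ p.V T i i := by
  have := (p.V_posSemidef h).diag_nonneg (i := i)
  rw [map_sub, Matrix.sub_apply] at this
  linarith

/-- Cauchy–Schwarz for the correlation of q_k with w·p under the joint covariance. -/
theorem abs_Z_mulVec_le {T : Matrix (Fin N) (Fin N) ℝ} (hT : T.PosSemidef) (k : Fin N)
    (w : Fin N → ℝ) : |(p.Z T *ᵥ w) k| ≤ √(p.U T k k) * √(w ⬝ᵥ p.V T *ᵥ w) := by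
  have h := abs_dotProduct_mulVec_le (p.cov_posSemidef hT)
    (Sum.elim (Pi.single k 1) 0) (Sum.elim 0 w)
  have hinl : ∀ a b : Fin N → ℝ, Sum.elim a b ∘ Sum.inl = a := fun a b => rfl
  have hinr : ∀ a b : Fin N → ℝ, Sum.elim a b ∘ Sum.inr = b := fun a b => rfl
  have e : Sum.elim (Pi.single k 1) 0 ⬝ᵥ p.cov N T *ᵥ Sum.elim 0 w = (p.Z T *ᵥ w) k := by
    rw [cov_eq_fromBlocks, fromBlocks_mulVec, hinl, hinr]
    simp [dotProduct, Pi.single_apply]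
  rw [e, cov_eq_fromBlocks, dotProduct_fromBlocks_mulVec, dotProduct_fromBlocks_mulVec] at h
  simpa only [hinl, hinr, zero_dotProduct, mulVec_zero, dotProduct_zero, add_zero, zero_add,
    mulVec_single_one, single_one_dotProduct, col_apply] using h

theorem isUnit_Φ (N : ℕ) : IsUnit (p.Φ N).det := by
  have hγ := p.γ_pos
  have : (p.Φ N).PosDef := by
    refine PosDef.of_dotProduct_mulVec_pos ?_ fun x hx => ?_
    · simpa [IsHermitian] using p.Φ_transpose N
    · rw [star_trivial]
      have h0 : 0 < x ⬝ᵥ x := by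
        simpa using dotProduct_star_self_pos_iff.2 hx
      exact (mul_pos (by positivity) h0).trans_le (p.le_dotProduct_Φ x)
  exact (Matrix.isUnit_iff_isUnit_det _).1 this.isUnit

/-- At equal temperatures the stationary state is the Gibbs state. -/
theorem blocks_one (N : ℕ) :
    p.U (1 : Matrix (Fin N) (Fin N) ℝ) = (p.Φ N)⁻¹ ∧ p.Z (1 : Matrix (Fin N) (Fin N) ℝ) = 0 ∧
      p.V (1 : Matrix (Fin N) (Fin N) ℝ) = 1 := by
  apply p.blocks_unique
  · rw [nonsing_inv_mul _ (p.isUnit_Φ N)]; simp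
  · rw [mul_nonsing_inv _ (p.isUnit_Φ N)]; simp
  · simp

theorem abs_U_one_le (i j : Fin N) : |p.U (1 : Matrix (Fin N) (Fin N) ℝ) i j| ≤ 1 / p.γ ^ 2 := by
  have h := p.abs_le_of_abs_Φ_le (v := fun i => p.U (1 : Matrix (Fin N) (Fin N) ℝ) i j)
    (ρ := 1) (fun k => ?_) i
  · exact h
  · have e : (p.Φ N *ᵥ fun i => p.U (1 : Matrix (Fin N) (Fin N) ℝ) i j) k =
        (p.Φ N * p.U (1 : Matrix (Fin N) (Fin N) ℝ)) k j := rfl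
    rw [e, (p.blocks_one N).1, mul_nonsing_inv _ (p.isUnit_Φ N), Matrix.one_apply]
    split_ifs <;> simp

theorem posSemidef_diagonal_sub {S T : Fin N → ℝ} (h : ∀ i, S i ≤ T i) :
    (diagonal T - diagonal S).PosSemidef := by
  rw [diagonal_sub]
  exact PosSemidef.diagonal fun i => sub_nonneg.2 (h i)

/-! ### The averaging kernel: positivity, normalisation and symmetry. -/

/-- The local temperature at the site `i` produced by a unit temperature at the site `j`. -/
noncomputable def kernel (i j : Fin N) : ℝ := p.V (Matrix.single j j 1) i i

theorem diagonal_eq_sum_single (T : Fin N → ℝ) :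
    diagonal T = ∑ j, T j • Matrix.single j j (1 : ℝ) := by
  ext a b
  rw [Matrix.sum_apply]
  simp only [Matrix.smul_apply, Matrix.single_apply, diagonal_apply, smul_eq_mul, mul_ite, mul_one,
    mul_zero]
  by_cases hab : a = b
  · subst hab; simp
  · rw [if_neg hab, Finset.sum_eq_zero]
    intro j _
    rw [if_neg]
    rintro ⟨rfl, rfl⟩
    exact hab rfl

theorem V_diagonal (T : Fin N → ℝ) (i : Fin N) :
    p.V (diagonal T) i i = ∑ j, p.kernel i j * T j := by
  rw [diagonal_eq_sum_single, map_sum, Matrix.sum_apply]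
  refine Finset.sum_congr rfl fun j _ => ?_
  rw [map_smul, Matrix.smul_apply, smul_eq_mul, mul_comm]
  rfl

theorem single_posSemidef (j : Fin N) : (Matrix.single j j (1 : ℝ)).PosSemidef := by
  rw [← Matrix.diagonal_single]
  refine PosSemidef.diagonal fun i => ?_
  rw [Pi.single_apply]
  split_ifs <;> simp

theorem one_sub_single_posSemidef (j : Fin N) : (1 - Matrix.single j j (1 : ℝ)).PosSemidef := by
  rw [← Matrix.diagonal_single, ← Matrix.diagonal_one]
  refine posSemidef_diagonal_sub fun i => ?_
  rw [Pi.single_apply]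
  split_ifs <;> simp

theorem kernel_nonneg (i j : Fin N) : 0 ≤ p.kernel i j :=
  (p.V_posSemidef (single_posSemidef j)).diag_nonneg

theorem sum_kernel (i : Fin N) : ∑ j, p.kernel i j = 1 := by
  have h := p.V_diagonal (fun _ => 1) i
  rw [Matrix.diagonal_one, (p.blocks_one N).2.2] at h
  simpa using h.symm

/-- Onsager reciprocity. Substituting the energy balance for S into 2λ tr(S V_T) and using [V_T, Φ]
= -λ(Z_T Φ + Φ Z_T) leaves an expression symmetric in S and T. -/
theorem trace_mul_V_comm (S T : Matrix (Fin N) (Fin N) ℝ) :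
    trace (S * p.V T) = trace (T * p.V S) := by
  have key : ∀ S T : Matrix (Fin N) (Fin N) ℝ, (2 * p.lam) * trace (S * p.V T) =
      (2 * p.lam) * trace (p.V S * p.V T) -
        p.lam * (trace (p.Z S * p.Z T * p.Φ N) + trace (p.Z T * p.Z S * p.Φ N)) := by
    intro S T
    have h1 : (2 * p.lam) * trace (S * p.V T) = trace (((2 * p.lam) • S) * p.V T) := by
      rw [smul_mul, trace_smul, smul_eq_mul]
    have h2 : p.V T * p.Φ N - p.Φ N * p.V T =
        -(p.lam • (p.Z T * p.Φ N)) - p.lam • (p.Φ N * p.Z T) := by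
      conv_lhs => rw [p.V_eq' T, sub_mul, ← p.V_eq' T, p.V_eq T]
      simp only [mul_add, Matrix.mul_smul, Matrix.smul_mul, mul_assoc]
      abel
    have h3 : trace (p.Φ N * p.Z S * p.V T) - trace (p.Z S * p.Φ N * p.V T) =
        trace (p.Z S * (p.V T * p.Φ N - p.Φ N * p.V T)) := by
      rw [mul_sub, trace_sub, mul_assoc, trace_mul_comm, mul_assoc, mul_assoc]
    rw [h1, ← p.energy_balance S, add_mul, sub_mul, trace_add, trace_sub, h3, h2, smul_mul,
      trace_smul, smul_eq_mul, mul_sub, trace_sub, mul_neg, trace_neg, Matrix.mul_smul, Matrix.mul_smul,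
      trace_smul, trace_smul, smul_eq_mul, smul_eq_mul, ← mul_assoc]
    have h4 : trace (p.Z S * (p.Φ N * p.Z T)) = trace (p.Z T * p.Z S * p.Φ N) := by
      rw [← mul_assoc, trace_mul_comm, mul_assoc]
    rw [h4]
    ring
  have h1 := key S T
  have h2 := key T S
  rw [trace_mul_comm (p.V T) (p.V S)] at h2
  have := p.lam_pos
  nlinarith

theorem kernel_comm (i j : Fin N) : p.kernel i j = p.kernel j i := by
  have h : ∀ i j : Fin N, trace (Matrix.single i i (1 : ℝ) * p.V (Matrix.single j j 1)) =
      p.kernel i j := by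
    intro i j
    rw [trace_mul_comm, kernel]
    simp [Matrix.trace_mul_single]
  rw [← h, ← h, trace_mul_V_comm]

/-! ### Explicit covariances and a quadratic supersolution. -/

/-- The matrix of temperatures for which `U` is the position-position block of the stationary
covariance. -/
noncomputable def bath (N : ℕ) : Matrix (Fin N) (Fin N) ℝ →ₗ[ℝ] Matrix (Fin N) (Fin N) ℝ :=
  (1 / 2 : ℝ) • (LinearMap.mulLeft ℝ (p.Φ N) + LinearMap.mulRight ℝ (p.Φ N)) +
    (1 / (4 * p.lam ^ 2)) • ((LinearMap.mulLeft ℝ (p.Φ N) - LinearMap.mulRight ℝ (p.Φ N)) ∘ₗ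
      (LinearMap.mulLeft ℝ (p.Φ N) - LinearMap.mulRight ℝ (p.Φ N)))

theorem bath_apply (U : Matrix (Fin N) (Fin N) ℝ) :
    p.bath N U = (1 / 2 : ℝ) • (p.Φ N * U + U * p.Φ N) + (1 / (4 * p.lam ^ 2)) •
      (p.Φ N * (p.Φ N * U - U * p.Φ N) - (p.Φ N * U - U * p.Φ N) * p.Φ N) := rfl

theorem bath_one : p.bath N 1 = p.Φ N := by
  rw [bath_apply]
  simp only [mul_one, one_mul, sub_self, mul_zero, zero_mul, smul_zero, add_zero, ← two_smul ℝ,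
    smul_smul]
  norm_num

theorem bath_transpose (U : Matrix (Fin N) (Fin N) ℝ) : (p.bath N U)ᵀ = p.bath N Uᵀ := by
  simp only [bath_apply, transpose_add, transpose_smul, transpose_sub, transpose_mul, p.Φ_transpose]
  congr 2
  · abel
  · noncomm_ring

/-- The block equations are read backwards: prescribing U determines Z, V and then the temperature
matrix. This matrix need not be diagonal, which is why the covariance was set up for arbitrary T. -/
theorem blocks_bath (U : Matrix (Fin N) (Fin N) ℝ) :
    p.U (p.bath N U) = U ∧ p.V (p.bath N U) = (1 / 2 : ℝ) • (p.Φ N * U + U * p.Φ N) := by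
  have hlam := p.lam_pos.ne'
  have h := p.blocks_unique (T := p.bath N U) (U := U)
    (Z := (1 / (2 * p.lam)) • (p.Φ N * U - U * p.Φ N))
    (V := (1 / 2 : ℝ) • (p.Φ N * U + U * p.Φ N)) ?_ ?_ ?_
  · exact ⟨h.1, h.2.2⟩
  · rw [smul_smul, show p.lam * (1 / (2 * p.lam)) = 1 / 2 by field_simp]
    module
  · rw [smul_smul, show p.lam * (1 / (2 * p.lam)) = 1 / 2 by field_simp]
    module
  · rw [bath_apply, smul_add (2 * p.lam), smul_smul (2 * p.lam) (1 / (4 * p.lam ^ 2)),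
      show 2 * p.lam * (1 / (4 * p.lam ^ 2)) = 1 / (2 * p.lam) by field_simp; norm_num,
      Matrix.mul_smul, Matrix.smul_mul, ← smul_sub, add_comm]

theorem dotProduct_Φ_comm (u v : Fin N → ℝ) : u ⬝ᵥ p.Φ N *ᵥ v = (p.Φ N *ᵥ u) ⬝ᵥ v := by
  rw [dotProduct_mulVec, ← mulVec_transpose, p.Φ_transpose]

/-- Everything is expressed through z = Xy and the commutator B = [Φ, X]. For X a displacement, z
may grow with N, while B has a norm bound independent of N. -/
theorem dotProduct_bath_sq {X : Matrix (Fin N) (Fin N) ℝ} (hX : Xᵀ = X) (y : Fin N → ℝ) :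
    y ⬝ᵥ p.bath N (X * X) *ᵥ y =
      (p.Φ N *ᵥ X *ᵥ y) ⬝ᵥ (X *ᵥ y) - ((p.Φ N * X - X * p.Φ N) *ᵥ y) ⬝ᵥ (X *ᵥ y) +
      1 / (2 * p.lam ^ 2) * ((p.Φ N *ᵥ X *ᵥ y) ⬝ᵥ ((p.Φ N * X - X * p.Φ N) *ᵥ y) -
        ((p.Φ N * X - X * p.Φ N) *ᵥ y) ⬝ᵥ ((p.Φ N * X - X * p.Φ N) *ᵥ y) -
        ((p.Φ N * X - X * p.Φ N) *ᵥ p.Φ N *ᵥ y) ⬝ᵥ (X *ᵥ y)) := by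
  have hXc : ∀ u v : Fin N → ℝ, u ⬝ᵥ X *ᵥ v = (X *ᵥ u) ⬝ᵥ v := fun u v => by
    rw [dotProduct_mulVec, ← mulVec_transpose, hX]
  rw [bath_apply]
  have hlam := p.lam_pos.ne'
  simp only [add_mulVec, smul_mulVec, sub_mulVec, ← mulVec_mulVec, mulVec_sub, dotProduct_add,
    dotProduct_sub, dotProduct_smul, sub_dotProduct, smul_eq_mul, p.dotProduct_Φ_comm, hXc]
  have e1 : (X *ᵥ X *ᵥ p.Φ N *ᵥ y) ⬝ᵥ y = (p.Φ N *ᵥ X *ᵥ X *ᵥ y) ⬝ᵥ y := by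
    rw [← hXc, ← hXc, ← p.dotProduct_Φ_comm, dotProduct_comm]
  have e2 : (X *ᵥ X *ᵥ p.Φ N *ᵥ p.Φ N *ᵥ y) ⬝ᵥ y = (p.Φ N *ᵥ p.Φ N *ᵥ X *ᵥ X *ᵥ y) ⬝ᵥ y := by
    rw [← hXc, ← hXc, ← p.dotProduct_Φ_comm, ← p.dotProduct_Φ_comm, dotProduct_comm]
  rw [e1, e2]
  field_simp
  ring

/-- A bound for the norm of the force matrix. -/
noncomputable def ΦBound : ℝ := 4 * p.ω ^ 2 + p.γ ^ 2

theorem ΦBound_pos : 0 < p.ΦBound := by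
  have := p.γ_pos
  unfold ΦBound; positivity

/-- The coefficient of the cross term in the lower bound for `bath (X ^ 2)`. -/
noncomputable def crossCoeff : ℝ := 2 * p.ω ^ 2 + 2 * p.ω ^ 2 * p.ΦBound / p.lam ^ 2

/-- The constant in the lower bound for `bath (X ^ 2)`. -/
noncomputable def defect : ℝ :=
  p.crossCoeff ^ 2 / (2 * p.γ ^ 2) + (2 * p.ω ^ 2) ^ 2 / (2 * p.lam ^ 2)

theorem defect_nonneg : 0 ≤ p.defect := by unfold defect; positivity

/-- The displacement from the site `j` as a diagonal matrix. -/
noncomputable def displacement (j : Fin N) : Matrix (Fin N) (Fin N) ℝ :=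
  diagonal fun k => (k : ℝ) - j

/-- Φ couples only nearest neighbours, between which the displacement changes by exactly 1. -/
theorem abs_commutator_le (j k l : Fin N) :
    |(p.Φ N * displacement j - displacement j * p.Φ N) k l| ≤ p.ω ^ 2 * neighbourMatrix N k l := by
  rw [displacement, Matrix.sub_apply, mul_diagonal, diagonal_mul, Φ_eq]
  simp only [Matrix.sub_apply, Matrix.smul_apply, smul_eq_mul]
  by_cases hkl : k = l
  · subst hkl
    have := mul_nonneg (sq_nonneg p.ω) (neighbourMatrix_nonneg k k)
    simpa [mul_comm] using this
  · rw [Matrix.one_apply_ne hkl]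
    have h0 := neighbourMatrix_nonneg k l
    have e : ((2 * p.ω ^ 2 + p.γ ^ 2) * 0 - p.ω ^ 2 * neighbourMatrix N k l) * ((l : ℝ) - j) -
        ((k : ℝ) - j) * ((2 * p.ω ^ 2 + p.γ ^ 2) * 0 - p.ω ^ 2 * neighbourMatrix N k l) =
        (p.ω ^ 2 * neighbourMatrix N k l) * ((k : ℝ) - l) := by ring
    rw [e, abs_mul, abs_of_nonneg (by positivity)]
    by_cases h : (k : ℕ) + 1 = l ∨ (l : ℕ) + 1 = k
    · have h1 : |(k : ℝ) - l| = 1 := by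
        rcases h with h | h
        · rw [← h]; simp
        · rw [← h]; simp
      rw [h1, mul_one]
    · simp [neighbourMatrix, h]

/-- The main term is z·Φz ≥ γ²|z|². All others contain B and are at most of order |y||z| or |y|²;
Young's inequality absorbs the cross terms into half of the main term. -/
theorem le_dotProduct_bath_sq (j : Fin N) (y : Fin N → ℝ) :
    p.γ ^ 2 / 2 * ((displacement j *ᵥ y) ⬝ᵥ (displacement j *ᵥ y)) - p.defect * (y ⬝ᵥ y) ≤
      y ⬝ᵥ p.bath N (displacement j * displacement j) *ᵥ y := by
  have hγ := p.γ_pos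
  have hlam := p.lam_pos
  rw [p.dotProduct_bath_sq (by simp [displacement])]
  set B := p.Φ N * displacement j - displacement j * p.Φ N with hB
  set z := displacement j *ᵥ y with hz
  set a := √(y ⬝ᵥ y) with ha
  set c := √(z ⬝ᵥ z) with hc
  have hB' : ∀ v : Fin N → ℝ, √((B *ᵥ v) ⬝ᵥ (B *ᵥ v)) ≤ (2 * p.ω ^ 2) * √(v ⬝ᵥ v) :=
    sqrt_mulVec_le_of_le_neighbour (sq_nonneg p.ω) (p.abs_commutator_le j)
  have hΦ : ∀ v : Fin N → ℝ, √((p.Φ N *ᵥ v) ⬝ᵥ (p.Φ N *ᵥ v)) ≤ p.ΦBound * √(v ⬝ᵥ v) :=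
    p.sqrt_Φ_mulVec_le
  have hK := p.ΦBound_pos
  have ha2 : a * a = y ⬝ᵥ y := Real.mul_self_sqrt (dotProduct_self_nonneg' y)
  have hc2 : c * c = z ⬝ᵥ z := Real.mul_self_sqrt (dotProduct_self_nonneg' z)
  have ha0 : 0 ≤ a := Real.sqrt_nonneg _
  have hc0 : 0 ≤ c := Real.sqrt_nonneg _
  have h1 : p.γ ^ 2 * (c * c) ≤ (p.Φ N *ᵥ z) ⬝ᵥ z := by
    rw [hc2, ← p.dotProduct_Φ_comm]; exact p.le_dotProduct_Φ z
  have h2 : (B *ᵥ y) ⬝ᵥ z ≤ 2 * p.ω ^ 2 * a * c :=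
    calc (B *ᵥ y) ⬝ᵥ z ≤ _ := le_of_abs_le (abs_dotProduct_le_sqrt_mul_sqrt _ _)
      _ ≤ _ := by gcongr; exact hB' y
  have h3 : -(p.ΦBound * c * (2 * p.ω ^ 2 * a)) ≤ (p.Φ N *ᵥ z) ⬝ᵥ (B *ᵥ y) := by
    refine neg_le_of_abs_le ((abs_dotProduct_le_sqrt_mul_sqrt _ _).trans ?_)
    gcongr
    · exact hΦ z
    · exact hB' y
  have h4 : (B *ᵥ y) ⬝ᵥ (B *ᵥ y) ≤ (2 * p.ω ^ 2) ^ 2 * (a * a) := by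
    rw [← Real.mul_self_sqrt (dotProduct_self_nonneg' (B *ᵥ y))]
    calc _ ≤ (2 * p.ω ^ 2 * a) * (2 * p.ω ^ 2 * a) := by gcongr <;> exact hB' y
      _ = _ := by ring
  have h5 : (B *ᵥ p.Φ N *ᵥ y) ⬝ᵥ z ≤ 2 * p.ω ^ 2 * (p.ΦBound * a) * c :=
    calc (B *ᵥ p.Φ N *ᵥ y) ⬝ᵥ z ≤ _ := le_of_abs_le (abs_dotProduct_le_sqrt_mul_sqrt _ _)
      _ ≤ _ := by
        gcongr
        refine (hB' _).trans ?_
        gcongr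
        exact hΦ y
  have h6 : 1 / (2 * p.lam ^ 2) * (-(p.ΦBound * c * (2 * p.ω ^ 2 * a)) -
      (2 * p.ω ^ 2) ^ 2 * (a * a) - 2 * p.ω ^ 2 * (p.ΦBound * a) * c) ≤
      1 / (2 * p.lam ^ 2) * ((p.Φ N *ᵥ z) ⬝ᵥ (B *ᵥ y) - (B *ᵥ y) ⬝ᵥ (B *ᵥ y) -
        (B *ᵥ p.Φ N *ᵥ y) ⬝ᵥ z) := by
    gcongr
  have h7 : 1 / (2 * p.lam ^ 2) * (-(p.ΦBound * c * (2 * p.ω ^ 2 * a)) -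
      (2 * p.ω ^ 2) ^ 2 * (a * a) - 2 * p.ω ^ 2 * (p.ΦBound * a) * c) =
      -((p.crossCoeff - 2 * p.ω ^ 2) * a * c) - (2 * p.ω ^ 2) ^ 2 / (2 * p.lam ^ 2) * (a * a) := by
    rw [crossCoeff]; field_simp; ring
  have h8 : p.crossCoeff * a * c ≤ p.γ ^ 2 / 2 * (c * c) +
      p.crossCoeff ^ 2 / (2 * p.γ ^ 2) * (a * a) := by
    have h := sq_nonneg (p.γ ^ 2 * c - p.crossCoeff * a)
    have e : p.γ ^ 2 / 2 * (c * c) + p.crossCoeff ^ 2 / (2 * p.γ ^ 2) * (a * a) -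
        p.crossCoeff * a * c = (p.γ ^ 2 * c - p.crossCoeff * a) ^ 2 / (2 * p.γ ^ 2) := by
      field_simp; ring
    have : 0 ≤ (p.γ ^ 2 * c - p.crossCoeff * a) ^ 2 / (2 * p.γ ^ 2) := by positivity
    linarith
  rw [← ha2, ← hc2, defect]
  linarith

/-- The slope of the quadratic majorant of the response to a parabolic temperature profile. -/
noncomputable def majSlope : ℝ := 2 / p.γ ^ 2

/-- The constant of the quadratic majorant of the response to a parabolic temperature profile. -/
noncomputable def majConst : ℝ := (1 + p.majSlope * p.defect) / p.γ ^ 2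

theorem majSlope_pos : 0 < p.majSlope := by
  have := p.γ_pos
  unfold majSlope; positivity

theorem majConst_pos : 0 < p.majConst := by
  have := p.γ_pos
  have := p.majSlope_pos
  have := p.defect_nonneg
  unfold majConst; positivity

/-- The parabolic temperature profile `1 + (k - j) ^ 2`. -/
noncomputable def parabola (j : Fin N) : Fin N → ℝ := fun k => 1 + ((k : ℝ) - j) ^ 2

/-- The quadratic majorant of the response to a parabolic temperature profile. -/
noncomputable def majorant (j : Fin N) : Matrix (Fin N) (Fin N) ℝ :=
  p.majSlope • (displacement j * displacement j) + p.majConst • 1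

theorem majorant_eq (j : Fin N) :
    p.majorant j = diagonal fun k : Fin N => p.majSlope * ((k : ℝ) - j) ^ 2 + p.majConst := by
  rw [majorant, displacement, diagonal_mul_diagonal, ← diagonal_one, ← diagonal_smul,
    ← diagonal_smul, diagonal_add]
  congr 1
  ext k
  simp [sq]

/-- The slope is chosen so that the quadratic part dominates (k - j)²; the constant then pays for
the 1 in the parabola and for the defect. By monotonicity in T, the explicit covariance of the
majorant bounds that of the parabola. -/
theorem bath_majorant_sub_posSemidef (j : Fin N) :
    (p.bath N (p.majorant j) - diagonal (parabola j)).PosSemidef := by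
  have hγ := p.γ_pos
  refine PosSemidef.of_dotProduct_mulVec_nonneg ?_ fun y => ?_
  · rw [IsHermitian, conjTranspose_eq_transpose_of_trivial, transpose_sub, bath_transpose,
      majorant_eq]
    simp
  · rw [star_trivial, sub_mulVec, dotProduct_sub, majorant, map_add, map_smul, map_smul, bath_one,
      add_mulVec, dotProduct_add, smul_mulVec, smul_mulVec, dotProduct_smul, dotProduct_smul,
      smul_eq_mul, smul_eq_mul]
    have h1 := mul_le_mul_of_nonneg_left (p.le_dotProduct_bath_sq j y) p.majSlope_pos.le
    have h2 := mul_le_mul_of_nonneg_left (p.le_dotProduct_Φ y) p.majConst_pos.le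
    have h3 : y ⬝ᵥ diagonal (parabola j) *ᵥ y = y ⬝ᵥ y +
        (displacement j *ᵥ y) ⬝ᵥ (displacement j *ᵥ y) := by
      simp only [dotProduct, displacement, mulVec_diagonal, parabola, ← Finset.sum_add_distrib]
      exact Finset.sum_congr rfl fun k _ => by ring
    have h4 : p.majConst * p.γ ^ 2 = 1 + p.majSlope * p.defect := by
      rw [majConst]; field_simp
    have h5 : p.majSlope * (p.γ ^ 2 / 2) = 1 := by
      rw [majSlope]; field_simp
    rw [h3]
    rw [← mul_assoc, h4] at h2
    rw [mul_sub, ← mul_assoc, h5] at h1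
    linarith

theorem U_parabola_le (j k : Fin N) :
    p.U (diagonal (parabola j)) k k ≤ p.majSlope * ((k : ℝ) - j) ^ 2 + p.majConst := by
  have h := p.U_apply_le (p.bath_majorant_sub_posSemidef j) k
  rw [(p.blocks_bath _).1, majorant_eq] at h
  simpa using h

/-- At the site j the displacement vanishes, so only Φ_jj times the constant of the majorant
survives. -/
theorem V_parabola_le (j : Fin N) :
    p.V (diagonal (parabola j)) j j ≤ p.ΦBound * p.majConst := by
  have h := p.V_apply_le (p.bath_majorant_sub_posSemidef j) j
  rw [(p.blocks_bath _).2, majorant_eq] at h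
  simp only [Matrix.smul_apply, Matrix.add_apply, mul_diagonal, diagonal_mul, Φ_diag, sub_self,
    smul_eq_mul] at h
  refine h.trans ?_
  have h1 := p.majConst_pos
  rw [ΦBound]
  nlinarith [sq_nonneg p.ω]

theorem sum_kernel_mul_sq_le (i : Fin N) :
    ∑ j : Fin N, p.kernel i j * ((j : ℝ) - i) ^ 2 ≤ p.ΦBound * p.majConst := by
  refine le_trans ?_ (p.V_parabola_le i)
  rw [V_diagonal]
  refine Finset.sum_le_sum fun j _ => ?_
  have := p.kernel_nonneg i j
  unfold parabola
  nlinarith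

/-! ### A uniform lower bound for nearest-neighbour entries of the kernel. -/

/-- The factor between the root of a small local temperature and the fluctuations around it. -/
noncomputable def propFactor : ℝ :=
  2 * p.ΦBound * ((1 + p.lam / p.γ) * (1 + (2 * p.ω ^ 2 + p.γ ^ 2) / p.γ ^ 2) / p.ω ^ 2)

theorem propFactor_pos : 0 < p.propFactor := by
  have := p.ω_pos
  have := p.γ_pos
  have := p.lam_pos
  have := p.ΦBound_pos
  unfold propFactor; positivity

/-- A uniform lower bound for the nearest neighbour kernel. -/
noncomputable def kernelBound : ℝ :=
  ((p.lam / (2 * p.ΦBound / p.γ + p.lam)) ^ 2 / p.propFactor) ^ 2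

theorem kernelBound_pos : 0 < p.kernelBound := by
  have := p.γ_pos
  have := p.lam_pos
  have := p.ΦBound_pos
  have := p.propFactor_pos
  unfold kernelBound; positivity

theorem abs_dotProduct_le_of_abs_le {u v : Fin N → ℝ} {a b : ℝ} (hu : ∀ k, |u k| ≤ a)
    (ha : 0 ≤ a) (hv : ∑ k, |v k| ≤ b) : |u ⬝ᵥ v| ≤ a * b :=
  calc |u ⬝ᵥ v| ≤ ∑ k, |u k * v k| := Finset.abs_sum_le_sum_abs _ _
    _ ≤ ∑ k, a * |v k| := by
        refine Finset.sum_le_sum fun k _ => ?_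
        rw [abs_mul]
        exact mul_le_mul_of_nonneg_right (hu k) (abs_nonneg _)
    _ ≤ a * b := by rw [← Finset.mul_sum]; gcongr

theorem sum_abs_Φ_mulVec_le (w : Fin N → ℝ) :
    ∑ k, |(p.Φ N *ᵥ w) k| ≤ p.ΦBound * ∑ k, |w k| :=
  calc ∑ k, |(p.Φ N *ᵥ w) k| ≤ ∑ k, ∑ l, |p.Φ N k l| * |w l| := by
        refine Finset.sum_le_sum fun k _ => ?_
        simp only [← abs_mul]
        exact Finset.abs_sum_le_sum_abs (fun l => p.Φ N k l * w l) Finset.univ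
    _ = ∑ l, (∑ k, |p.Φ N k l|) * |w l| := by
        rw [Finset.sum_comm]; simp only [Finset.sum_mul]
    _ ≤ ∑ l, p.ΦBound * |w l| := by
        refine Finset.sum_le_sum fun l _ => ?_
        have h := p.Φ_row_le l
        rw [← p.Φ_transpose] at h
        exact mul_le_mul_of_nonneg_right h (abs_nonneg _)
    _ = _ := by rw [Finset.mul_sum]

/-- Heat only the site j and let s² be the momentum variance at its neighbour i. If s were small,
Cauchy–Schwarz would make row i of V and of Z small, hence those of UΦ and ΦU, hence row i of U. As
Φ couples i to its neighbours, Uw would be small too, with w the indicator of the neighbours of i.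
So w·Vw = O(s) and Zw = O(√s). The energy balance tested on w then contradicts w·Tw = 1, which holds
because j is a neighbour of i. -/
theorem kernelBound_le {i j : Fin N} (hij : neighbourMatrix N j i = 1) :
    p.kernelBound ≤ p.kernel i j := by
  have hω := p.ω_pos
  have hγ := p.γ_pos
  have hlam := p.lam_pos
  have hK := p.ΦBound_pos
  have hF := p.propFactor_pos
  set T : Matrix (Fin N) (Fin N) ℝ := Matrix.single j j 1 with hT
  have hTp : T.PosSemidef := single_posSemidef j
  have hT1 : (1 - T).PosSemidef := one_sub_single_posSemidef j
  have hTt : Tᵀ = T := by simpa using hTp.isHermitian.eq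
  set s := √(p.kernel i j) with hs
  have hs0 : 0 ≤ s := Real.sqrt_nonneg _
  have hUs : ∀ a b, p.U T a b = p.U T b a := fun a b => by
    have h := p.U_transpose T
    rw [hTt] at h
    exact congrFun₂ h b a
  have hZs : (p.Z T)ᵀ = -p.Z T := by rw [Z_transpose, hTt]
  have hUk : ∀ k, √(p.U T k k) ≤ 1 / p.γ := fun k => by
    rw [Real.sqrt_le_left (by positivity), div_pow, one_pow]
    exact (p.U_apply_le hT1 k).trans (le_of_abs_le (p.abs_U_one_le k k))
  have hVk : ∀ k, √(p.V T k k) ≤ 1 := fun k => by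
    rw [Real.sqrt_le_one]
    refine (p.V_apply_le hT1 k).trans ?_
    rw [(p.blocks_one N).2.2, Matrix.one_apply_eq]
  have hVi : √(p.V T i i) = s := rfl
  have hVrow : ∀ k, |p.V T i k| ≤ s := fun k => by
    have h := abs_dotProduct_mulVec_le (p.V_posSemidef hTp) (Pi.single i 1) (Pi.single k 1)
    simp only [mulVec_single_one, single_one_dotProduct, col_apply] at h
    rw [hVi] at h
    nlinarith [hVk k]
  have hZcol : ∀ k, |p.Z T k i| ≤ s / p.γ := fun k => by
    have h := p.abs_Z_mulVec_le hTp k (Pi.single i 1)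
    simp only [mulVec_single_one, single_one_dotProduct, col_apply] at h
    rw [hVi] at h
    refine h.trans ?_
    calc √(p.U T k k) * s ≤ 1 / p.γ * s := by gcongr; exact hUk k
      _ = s / p.γ := by ring
  have hZrow : ∀ k, |p.Z T i k| ≤ s / p.γ := fun k => by
    have h : p.Z T i k = -p.Z T k i := congrFun₂ hZs k i
    rw [h, abs_neg]
    exact hZcol k
  set ρ := (1 + p.lam / p.γ) * s with hρ
  have hρ0 : 0 ≤ ρ := by positivity
  have hlZ : ∀ k, |p.lam * p.Z T i k| ≤ p.lam * (s / p.γ) := fun k => by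
    rw [abs_mul, abs_of_pos hlam]
    exact mul_le_mul_of_nonneg_left (hZrow k) hlam.le
  have hρe : ρ = s + p.lam * (s / p.γ) := by rw [hρ]; field_simp
  have hUΦ : ∀ k, |(p.U T * p.Φ N) i k| ≤ ρ := fun k => by
    have e : (p.U T * p.Φ N) i k = p.V T i k - p.lam * p.Z T i k := by
      rw [V_eq]; simp
    rw [e, hρe]
    exact (abs_sub _ _).trans (add_le_add (hVrow k) (hlZ k))
  have hΦU : ∀ k, |(p.Φ N * p.U T) i k| ≤ ρ := fun k => by
    have e : (p.Φ N * p.U T) i k = p.V T i k + p.lam * p.Z T i k := by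
      rw [V_eq']; simp
    rw [e, hρe]
    exact (abs_add_le _ _).trans (add_le_add (hVrow k) (hlZ k))
  have hUi : ∀ k, |p.U T i k| ≤ ρ / p.γ ^ 2 := by
    refine p.abs_le_of_abs_Φ_le (v := fun k => p.U T i k) fun k => ?_
    have e : (p.Φ N *ᵥ fun k => p.U T i k) k = (p.U T * p.Φ N) i k := by
      simp only [mulVec, dotProduct, mul_apply]
      refine Finset.sum_congr rfl fun l _ => ?_
      rw [mul_comm, ← congrFun₂ (p.Φ_transpose N) k l, transpose_apply]
    rw [e]
    exact hUΦ k
  set w : Fin N → ℝ := fun k => neighbourMatrix N k i with hw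
  have hw1 : ∑ k, |w k| ≤ 2 := by
    refine le_of_eq_of_le (Finset.sum_congr rfl fun k _ => ?_) (sum_neighbourMatrix_le i)
    rw [abs_of_nonneg (neighbourMatrix_nonneg _ _), neighbourMatrix_comm]
  have hΦw : ∑ k, |(p.Φ N *ᵥ w) k| ≤ 2 * p.ΦBound := by
    refine (p.sum_abs_Φ_mulVec_le w).trans ?_
    nlinarith
  set ρ' := ρ * (1 + (2 * p.ω ^ 2 + p.γ ^ 2) / p.γ ^ 2) / p.ω ^ 2 with hρ'
  have hρ'0 : 0 ≤ ρ' := by positivity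
  -- Row i of ΦU is (2ω² + γ²) times row i of U minus ω² Uw; solving for Uw uses ω ≠ 0.
  have hUw : ∀ k, |(p.U T *ᵥ w) k| ≤ ρ' := fun k => by
    have e : (p.Φ N * p.U T) i k =
        (2 * p.ω ^ 2 + p.γ ^ 2) * p.U T i k - p.ω ^ 2 * (p.U T *ᵥ w) k := by
      rw [Φ_eq, sub_mul, Matrix.sub_apply, Matrix.smul_mul, Matrix.smul_mul, one_mul]
      simp only [Matrix.smul_apply, smul_eq_mul]
      congr 2
      rw [mul_apply]
      refine Finset.sum_congr rfl fun l _ => ?_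
      rw [hUs l k, neighbourMatrix_comm i l, mul_comm]
    have e2 : (p.U T *ᵥ w) k =
        ((2 * p.ω ^ 2 + p.γ ^ 2) * p.U T i k - (p.Φ N * p.U T) i k) / p.ω ^ 2 := by
      rw [e]; field_simp; ring
    rw [e2, abs_div, abs_of_pos (by positivity : 0 < p.ω ^ 2), hρ']
    gcongr
    refine (abs_sub _ _).trans ?_
    rw [abs_mul, abs_of_pos (by positivity : 0 < 2 * p.ω ^ 2 + p.γ ^ 2)]
    have h1 : (2 * p.ω ^ 2 + p.γ ^ 2) * |p.U T i k| ≤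
        (2 * p.ω ^ 2 + p.γ ^ 2) * (ρ / p.γ ^ 2) := by gcongr; exact hUi k
    calc _ ≤ (2 * p.ω ^ 2 + p.γ ^ 2) * (ρ / p.γ ^ 2) + ρ := add_le_add h1 (hΦU k)
      _ = _ := by ring
  have hZc : ∀ u v : Fin N → ℝ, u ⬝ᵥ p.Z T *ᵥ v = -((p.Z T *ᵥ u) ⬝ᵥ v) := fun u v => by
    rw [dotProduct_mulVec, ← mulVec_transpose, hZs, neg_mulVec, neg_dotProduct]
  have hUc : ∀ u v : Fin N → ℝ, u ⬝ᵥ p.U T *ᵥ v = (p.U T *ᵥ u) ⬝ᵥ v := fun u v => by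
    rw [dotProduct_mulVec, ← mulVec_transpose, U_transpose, hTt]
  have hwVw : w ⬝ᵥ p.V T *ᵥ w ≤ p.propFactor * s := by
    have hzero : w ⬝ᵥ p.Z T *ᵥ w = 0 := by
      have h := hZc w w
      rw [dotProduct_comm (p.Z T *ᵥ w)] at h
      linarith
    rw [V_eq, add_mulVec, dotProduct_add, smul_mulVec, dotProduct_smul, hzero, smul_zero,
      add_zero, ← mulVec_mulVec, hUc]
    refine (le_of_abs_le (abs_dotProduct_le_of_abs_le hUw hρ'0 hΦw)).trans_eq ?_
    rw [hρ', hρ, propFactor]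
    ring
  set h := p.propFactor * s with hh
  have hh0 : 0 ≤ h := by positivity
  have hZw : ∀ k, |(p.Z T *ᵥ w) k| ≤ 1 / p.γ * √h := fun k =>
    (p.abs_Z_mulVec_le hTp k w).trans
      (mul_le_mul (hUk k) (Real.sqrt_le_sqrt hwVw) (Real.sqrt_nonneg _) (by positivity))
  -- By antisymmetry of Z both commutator terms equal (Φw)·(Zw).
  have hbal : p.lam ≤ 2 * p.ΦBound / p.γ * √h + p.lam * h := by
    have e := congrArg (fun M => w ⬝ᵥ M *ᵥ w) (p.energy_balance T)
    simp only [add_mulVec, sub_mulVec, smul_mulVec, dotProduct_add, dotProduct_sub,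
      dotProduct_smul, ← mulVec_mulVec, p.dotProduct_Φ_comm, smul_eq_mul] at e
    rw [hZc w (p.Φ N *ᵥ w), dotProduct_comm (p.Φ N *ᵥ w) (p.Z T *ᵥ w)] at e
    have hwT : w ⬝ᵥ T *ᵥ w = 1 := by
      rw [hT, ← Matrix.diagonal_single]
      simp [dotProduct, mulVec_diagonal, Pi.single_apply, hw, hij]
    have hb := le_of_abs_le (abs_dotProduct_le_of_abs_le hZw (by positivity) hΦw)
    have e3 : 1 / p.γ * √h * (2 * p.ΦBound) = 2 * p.ΦBound / p.γ * √h := by ring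
    rw [hwT] at e
    rw [e3] at hb
    have h5 := mul_le_mul_of_nonneg_left hwVw hlam.le
    linarith
  set c := 2 * p.ΦBound / p.γ + p.lam with hc
  have hc0 : 0 < c := by positivity
  have hcl : p.lam / c ≤ 1 := by
    rw [div_le_one hc0, hc]
    have : 0 ≤ 2 * p.ΦBound / p.γ := by positivity
    linarith
  have hsqrt : p.lam / c ≤ √h := by
    -- For √h < 1 one has h ≤ √h, so the balance reads λ ≤ c√h; otherwise λ/c ≤ 1 suffices.
    by_cases h1 : 1 ≤ √h
    · exact hcl.trans h1
    · push Not at h1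
      have h2 : h ≤ √h := by
        have h3 := Real.mul_self_sqrt hh0
        nlinarith [Real.sqrt_nonneg h]
      rw [div_le_iff₀ hc0, hc]
      nlinarith
  have hsq : (p.lam / c) ^ 2 ≤ h := by
    rw [← Real.sq_sqrt hh0]
    gcongr
  have hs1 : (p.lam / c) ^ 2 / p.propFactor ≤ s := by
    rw [div_le_iff₀ hF, mul_comm]
    exact hsq
  have hs2 : s ^ 2 = p.kernel i j := Real.sq_sqrt (p.kernel_nonneg i j)
  rw [← hs2, kernelBound]
  gcongr

end Params

/-! ### Nearest-neighbour variation of a profile. -/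

theorem abs_sub_le_maxVariation {N : ℕ} (T : Fin N → ℝ) (b : Fin (N - 1)) :
    |T (leftSite b) - T (rightSite b)| ≤ maxVariation T :=
  le_ciSup (f := fun b => |T (leftSite b) - T (rightSite b)|) (Set.finite_range _).bddAbove b

theorem maxVariation_nonneg {N : ℕ} (T : Fin N → ℝ) : 0 ≤ maxVariation T :=
  Real.iSup_nonneg fun _ => abs_nonneg _

theorem abs_sub_le_dist_mul_maxVariation {N : ℕ} (T : Fin N → ℝ) (k j : Fin N) :
    |T k - T j| ≤ |(k : ℝ) - j| * maxVariation T := by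
  have key : ∀ (j d : ℕ) (h : j + d < N),
      |T ⟨j + d, h⟩ - T ⟨j, by omega⟩| ≤ d * maxVariation T := by
    intro j d
    induction d with
    | zero => intro h; simp
    | succ d ih =>
      intro h
      have h1 := ih (by omega)
      have h2 := abs_sub_le_maxVariation T ⟨j + d, by omega⟩
      have h3 := abs_sub_le (T ⟨j + (d + 1), h⟩) (T ⟨j + d, by omega⟩) (T ⟨j, by omega⟩)
      rw [abs_sub_comm] at h2
      change |T ⟨j + d + 1, _⟩ - T ⟨j + d, _⟩| ≤ _ at h2
      push_cast
      change |T ⟨j + d + 1, _⟩ - T ⟨j, _⟩| ≤ |T ⟨j + d + 1, _⟩ - T ⟨j + d, _⟩| + _ at h3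
      change |T ⟨j + d + 1, _⟩ - T ⟨j, _⟩| ≤ _
      linarith
  rcases le_total (j : ℕ) k with h | h
  · have := key j (k - j) (by omega)
    rw [Nat.cast_sub h] at this
    rw [abs_of_nonneg (sub_nonneg.2 (by exact_mod_cast h) : (0 : ℝ) ≤ (k : ℝ) - j)]
    convert this using 4
    exact Fin.ext (by simp; omega)
  · have := key k (j - k) (by omega)
    rw [Nat.cast_sub h] at this
    rw [abs_sub_comm, abs_sub_comm (k : ℝ),
      abs_of_nonneg (sub_nonneg.2 (by exact_mod_cast h) : (0 : ℝ) ≤ (j : ℝ) - k)]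
    convert this using 4
    exact Fin.ext (by simp; omega)

namespace Params

open Matrix

variable (p : Params) {N : ℕ}

/-! ### Balanced profiles: minimum principle, uniqueness and existence. -/

/-- The temperature of every interior reservoir equals the local kinetic temperature. -/
def IsBalanced (T : Fin N → ℝ) : Prop :=
  ∀ i : Fin N, 0 < (i : ℕ) → (i : ℕ) + 1 < N → p.V (diagonal T) i i = T i

theorem neighbourMatrix_pred {i : Fin N} (hi : 0 < (i : ℕ)) :
    neighbourMatrix N ⟨i - 1, by omega⟩ i = 1 := by
  simp only [neighbourMatrix, of_apply]
  rw [if_pos]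
  left
  omega

variable {p} in
/-- The minimum principle for balanced profiles. -/
theorem IsBalanced.le {T : Fin N → ℝ} (hT : p.IsBalanced T) {c : ℝ}
    (hl : ∀ i : Fin N, (i : ℕ) = 0 → c ≤ T i) (hr : ∀ i : Fin N, (i : ℕ) + 1 = N → c ≤ T i)
    (i : Fin N) : c ≤ T i := by
  obtain ⟨m, -, hm⟩ := Finset.exists_min_image Finset.univ T ⟨i, Finset.mem_univ i⟩
  have hm' : ∀ k, T m ≤ T k := fun k => hm k (Finset.mem_univ k)
  refine le_trans ?_ (hm' i)
  -- At an interior minimum the averaged differences sum to 0 with nonnegative terms. Positivity of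
  -- the entry towards the left neighbour passes the minimum on to it, down to the left end.
  have key : ∀ (n : ℕ) (k : Fin N), (k : ℕ) = n → T k = T m → c ≤ T m := by
    intro n
    induction n with
    | zero => intro k hk hkm; rw [← hkm]; exact hl k hk
    | succ n ih =>
      intro k hk hkm
      by_cases hkN : (k : ℕ) + 1 = N
      · rw [← hkm]; exact hr k hkN
      · have hk0 : 0 < (k : ℕ) := by omega
        have hb := hT k hk0 (by omega)
        rw [V_diagonal] at hb
        have hsum : ∑ j, p.kernel k j * (T j - T m) = 0 := by
          simp only [mul_sub, Finset.sum_sub_distrib, ← Finset.sum_mul, p.sum_kernel, hb, hkm]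
          ring
        have hz := (Finset.sum_eq_zero_iff_of_nonneg fun j _ =>
          mul_nonneg (p.kernel_nonneg k j) (sub_nonneg.2 (hm' j))).1 hsum
          ⟨k - 1, by omega⟩ (Finset.mem_univ _)
        have hpos := p.kernelBound_pos.trans_le (p.kernelBound_le (neighbourMatrix_pred hk0))
        refine ih ⟨k - 1, by omega⟩ (by simp; omega) ?_
        rcases mul_eq_zero.1 hz with h | h
        · exact absurd h hpos.ne'
        · linarith
  exact key m m rfl rfl

theorem IsBalanced.sub {S T : Fin N → ℝ} (hS : p.IsBalanced S) (hT : p.IsBalanced T) :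
    p.IsBalanced (S - T) := by
  intro i h0 h1
  have e : diagonal (S - T) = diagonal S - diagonal T := by rw [diagonal_sub]; rfl
  rw [e, map_sub, Matrix.sub_apply, hS i h0 h1, hT i h0 h1]
  rfl

theorem IsBalanced.eq {S T : Fin N → ℝ} (hS : p.IsBalanced S) (hT : p.IsBalanced T)
    (hl : ∀ i : Fin N, (i : ℕ) = 0 → S i = T i) (hr : ∀ i : Fin N, (i : ℕ) + 1 = N → S i = T i) :
    S = T := by
  ext i
  have h1 := (hS.sub p hT).le (c := 0) (fun i hi => by simp [hl i hi])
    (fun i hi => by simp [hr i hi]) i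
  have h2 := (hT.sub p hS).le (c := 0) (fun i hi => by simp [hl i hi])
    (fun i hi => by simp [hr i hi]) i
  simp only [Pi.sub_apply] at h1 h2
  linarith

/-- The linear system for the self-consistent profile. -/
noncomputable def balanceMap (N : ℕ) : (Fin N → ℝ) →ₗ[ℝ] (Fin N → ℝ) where
  toFun T := fun i =>
    if 0 < (i : ℕ) ∧ (i : ℕ) + 1 < N then T i - ∑ j, p.kernel i j * T j else T i
  map_add' S T := by
    ext i
    simp only [Pi.add_apply, mul_add, Finset.sum_add_distrib]
    split_ifs <;> ring
  map_smul' c T := by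
    ext i
    simp only [Pi.smul_apply, smul_eq_mul, RingHom.id_apply, mul_left_comm, ← Finset.mul_sum]
    split_ifs <;> ring

/-- Uniqueness makes the square linear system injective, hence surjective. Signs of the end values
play no role here. -/
theorem exists_isBalanced (hN : 2 ≤ N) (TL TR : ℝ) : ∃ T : Fin N → ℝ, p.IsBalanced T ∧
    (∀ i : Fin N, (i : ℕ) = 0 → T i = TL) ∧ ∀ i : Fin N, (i : ℕ) + 1 = N → T i = TR := by
  have hend : ∀ (T : Fin N → ℝ) (i : Fin N), ¬(0 < (i : ℕ) ∧ (i : ℕ) + 1 < N) →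
      p.balanceMap N T i = T i := fun T i hi => if_neg hi
  have hint : ∀ (T : Fin N → ℝ) (i : Fin N), (0 < (i : ℕ) ∧ (i : ℕ) + 1 < N) →
      p.balanceMap N T i = T i - p.V (diagonal T) i i := fun T i hi => by
    rw [V_diagonal]; exact if_pos hi
  have hinj : Function.Injective (p.balanceMap N) := by
    rw [injective_iff_map_eq_zero]
    intro T hT
    refine IsBalanced.eq p (fun i h0 h1 => ?_) (fun i _ _ => ?_) (fun i hi => ?_) fun i hi => ?_
    · have := hint T i ⟨h0, h1⟩
      rw [hT, Pi.zero_apply] at this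
      linarith
    · have : diagonal (0 : Fin N → ℝ) = 0 := diagonal_zero
      simp [this]
    · rw [← hend T i (by omega), hT]
    · rw [← hend T i (by omega), hT]
  obtain ⟨T, hT⟩ := LinearMap.injective_iff_surjective.1 hinj
    fun i => if (i : ℕ) = 0 then TL else if (i : ℕ) + 1 = N then TR else 0
  refine ⟨T, fun i h0 h1 => ?_, fun i hi => ?_, fun i hi => ?_⟩
  · have := hint T i ⟨h0, h1⟩
    rw [hT] at this
    simp only at this
    rw [if_neg h0.ne', if_neg h1.ne] at this
    linarith
  · rw [← hend T i (by omega), hT]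
    simp [hi]
  · rw [← hend T i (by omega), hT]
    simp only
    rw [if_neg (by omega), if_pos hi]

/-! ### The Dirichlet principle and the bound for the maximal variation. -/

/-- The Dirichlet form of the kernel. -/
noncomputable def dirichlet (T : Fin N → ℝ) : ℝ :=
  ∑ i, ∑ j, p.kernel i j * (T i - T j) ^ 2

/-- The Dirichlet principle. -/
theorem IsBalanced.dirichlet_le {S T : Fin N → ℝ} (hT : p.IsBalanced T)
    (hl : ∀ i : Fin N, (i : ℕ) = 0 → S i = T i) (hr : ∀ i : Fin N, (i : ℕ) + 1 = N → S i = T i) :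
    p.dirichlet T ≤ p.dirichlet S := by
  set D : Fin N → ℝ := S - T with hD
  -- Each row vanishes: harmonicity kills the interior rows, and D = 0 at the two ends.
  have h0 : ∑ i, ∑ j, p.kernel i j * ((T i - T j) * D i) = 0 := by
    refine Finset.sum_eq_zero fun i _ => ?_
    by_cases hi : 0 < (i : ℕ) ∧ (i : ℕ) + 1 < N
    · have e : ∑ j, p.kernel i j * ((T i - T j) * D i) =
          ((∑ j, p.kernel i j) * T i - ∑ j, p.kernel i j * T j) * D i := by
        rw [Finset.sum_mul, ← Finset.sum_sub_distrib, Finset.sum_mul]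
        exact Finset.sum_congr rfl fun j _ => by ring
      rw [e, p.sum_kernel, ← V_diagonal, hT i hi.1 hi.2]
      ring
    · have : D i = 0 := by
        rw [hD, Pi.sub_apply, sub_eq_zero]
        by_cases hi0 : (i : ℕ) = 0
        · exact hl i hi0
        · exact hr i (by omega)
      simp [this]
  have h1 : ∑ i, ∑ j, p.kernel i j * ((T i - T j) * D j) = 0 := by
    rw [Finset.sum_comm, ← neg_eq_zero, ← h0, ← Finset.sum_neg_distrib]
    refine Finset.sum_congr rfl fun i _ => ?_
    rw [← Finset.sum_neg_distrib]
    refine Finset.sum_congr rfl fun j _ => ?_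
    rw [p.kernel_comm]
    ring
  have h2 : p.dirichlet S = p.dirichlet T + p.dirichlet D +
      2 * (∑ i, ∑ j, p.kernel i j * ((T i - T j) * D i) -
        ∑ i, ∑ j, p.kernel i j * ((T i - T j) * D j)) := by
    simp only [dirichlet, ← Finset.sum_add_distrib, ← Finset.sum_sub_distrib, Finset.mul_sum]
    refine Finset.sum_congr rfl fun i _ => Finset.sum_congr rfl fun j _ => ?_
    simp only [hD, Pi.sub_apply]
    ring
  have h3 : 0 ≤ p.dirichlet D := Finset.sum_nonneg fun i _ => Finset.sum_nonneg fun j _ =>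
    mul_nonneg (p.kernel_nonneg i j) (sq_nonneg _)
  rw [h2, h0, h1]
  linarith

theorem kernelBound_mul_sq_le_dirichlet (T : Fin N → ℝ) (b : Fin (N - 1)) :
    p.kernelBound * (T (leftSite b) - T (rightSite b)) ^ 2 ≤ p.dirichlet T := by
  have hn : neighbourMatrix N (rightSite b) (leftSite b) = 1 := by
    simp [neighbourMatrix, leftSite, rightSite]
  have hnn : ∀ i j, 0 ≤ p.kernel i j * (T i - T j) ^ 2 := fun i j =>
    mul_nonneg (p.kernel_nonneg i j) (sq_nonneg _)
  calc _ ≤ p.kernel (leftSite b) (rightSite b) * (T (leftSite b) - T (rightSite b)) ^ 2 :=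
        mul_le_mul_of_nonneg_right (p.kernelBound_le hn) (sq_nonneg _)
    _ ≤ ∑ j, p.kernel (leftSite b) j * (T (leftSite b) - T j) ^ 2 :=
        Finset.single_le_sum (f := fun j => p.kernel (leftSite b) j * (T (leftSite b) - T j) ^ 2)
          (fun j _ => hnn _ j) (Finset.mem_univ _)
    _ ≤ p.dirichlet T :=
        Finset.single_le_sum (f := fun i => ∑ j, p.kernel i j * (T i - T j) ^ 2)
          (fun i _ => Finset.sum_nonneg fun j _ => hnn i j) (Finset.mem_univ _)

/-- The constant in the bound for the maximal variation. -/
noncomputable def variationConst : ℝ := √(4 * (p.ΦBound * p.majConst) / p.kernelBound)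

theorem IsBalanced.maxVariation_le (hN : 2 ≤ N) {T : Fin N → ℝ} (hT : p.IsBalanced T) {TL TR : ℝ}
    (hl : ∀ i : Fin N, (i : ℕ) = 0 → T i = TL) (hr : ∀ i : Fin N, (i : ℕ) + 1 = N → T i = TR) :
    maxVariation T ≤ p.variationConst * |TL - TR| * (N : ℝ) ^ (-(1 / 2) : ℝ) := by
  have hN' : (2 : ℝ) ≤ N := by exact_mod_cast hN
  have hN1 : (0 : ℝ) < (N : ℝ) - 1 := by linarith
  have hk := p.kernelBound_pos
  have hK : 0 < p.ΦBound * p.majConst := mul_pos p.ΦBound_pos p.majConst_pos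
  have hlin : p.dirichlet T ≤ 4 * (p.ΦBound * p.majConst) * (TL - TR) ^ 2 / N := by
    have h1 := hT.dirichlet_le p
      (S := fun i => TL + (i : ℝ) * ((TR - TL) / ((N : ℝ) - 1)))
      (fun i hi => by rw [hl i hi]; simp [hi])
      (fun i hi => by
        have : (i : ℝ) = (N : ℝ) - 1 := by
          have : ((i : ℕ) : ℝ) + 1 = N := by exact_mod_cast hi
          linarith
        rw [hr i hi, this]; field_simp; ring)
    refine h1.trans ?_
    -- For the linear trial profile, a row of the form is the squared slope times the second moment
    -- of the kernel.
    have h2 : ∀ i : Fin N, ∑ j : Fin N, p.kernel i j *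
        (TL + (i : ℝ) * ((TR - TL) / ((N : ℝ) - 1)) -
          (TL + (j : ℝ) * ((TR - TL) / ((N : ℝ) - 1)))) ^ 2 ≤
        (p.ΦBound * p.majConst) * ((TR - TL) / ((N : ℝ) - 1)) ^ 2 := by
      intro i
      refine le_trans (le_of_eq ?_)
        (mul_le_mul_of_nonneg_right (p.sum_kernel_mul_sq_le i) (sq_nonneg _))
      rw [Finset.sum_mul]
      exact Finset.sum_congr rfl fun j _ => by ring
    refine (Finset.sum_le_sum fun i _ => h2 i).trans ?_
    rw [Finset.sum_const, Finset.card_univ, Fintype.card_fin, nsmul_eq_mul]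
    have h3 : (N : ℝ) / ((N : ℝ) - 1) ^ 2 ≤ 4 / N := by
      rw [div_le_div_iff₀ (by positivity) (by positivity)]
      nlinarith
    have h4 : 0 ≤ (p.ΦBound * p.majConst) * (TL - TR) ^ 2 := by positivity
    calc _ = (p.ΦBound * p.majConst) * (TL - TR) ^ 2 * ((N : ℝ) / ((N : ℝ) - 1) ^ 2) := by
          field_simp; ring
      _ ≤ (p.ΦBound * p.majConst) * (TL - TR) ^ 2 * (4 / N) := by gcongr
      _ = _ := by ring
  have : Nonempty (Fin (N - 1)) := ⟨⟨0, by omega⟩⟩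
  refine ciSup_le fun b => ?_
  have hb := (p.kernelBound_mul_sq_le_dirichlet T b).trans hlin
  have e : p.variationConst * |TL - TR| * (N : ℝ) ^ (-(1 / 2) : ℝ) =
      √(4 * (p.ΦBound * p.majConst) / p.kernelBound * (TL - TR) ^ 2 / N) := by
    rw [Real.sqrt_div (by positivity), Real.sqrt_mul (by positivity), Real.sqrt_sq_eq_abs,
      Real.rpow_neg (by positivity), ← Real.sqrt_eq_rpow, variationConst]
    ring
  rw [e]
  refine Real.abs_le_sqrt ?_
  rw [mul_comm, ← le_div_iff₀ hk] at hb
  refine hb.trans (le_of_eq ?_)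
  field_simp

/-! ### The current as a gradient, and its conservation. -/

/-- The entry `(i - 1, i + 1)` of a matrix, extended by zero. -/
def crossEntry (M : Matrix (Fin N) (Fin N) ℝ) (i : Fin N) : ℝ :=
  if h : 0 < (i : ℕ) ∧ (i : ℕ) + 1 < N then M ⟨i - 1, by omega⟩ ⟨i + 1, h.2⟩ else 0

/-- The local function `⟨q_i ^ 2⟩ - ⟨q_{i-1} q_{i+1}⟩`, whose discrete gradient is the current. -/
def potential (M : Matrix (Fin N) (Fin N) ℝ) (i : Fin N) : ℝ := M i i - crossEntry M i

theorem potential_sub_smul (L M : Matrix (Fin N) (Fin N) ℝ) (c : ℝ) (i : Fin N) :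
    potential (L - c • M) i = potential L i - c * potential M i := by
  unfold potential crossEntry
  split_ifs
  · simp; ring
  · simp

theorem pad_left (M : Matrix (Fin N) (Fin N) ℝ) (b : Fin (N - 1)) :
    pad (fun k => M k (rightSite b)) (leftSite b) = crossEntry M (leftSite b) := by
  obtain ⟨n, hn⟩ := b
  rcases n with _ | n
  · rw [crossEntry, dif_neg fun h => lt_irrefl _ h.1]
    exact pad_zero _
  · have h : 0 < (leftSite ⟨n + 1, hn⟩ : ℕ) ∧ (leftSite ⟨n + 1, hn⟩ : ℕ) + 1 < N :=
      ⟨Nat.succ_pos n, by change n + 1 + 1 < N; omega⟩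
    rw [crossEntry, dif_pos h]
    exact pad_succ (fun k => M k (rightSite ⟨n + 1, hn⟩)) (by omega : n < N)

theorem pad_right {M : Matrix (Fin N) (Fin N) ℝ} (hM : ∀ i j, M i j = M j i) (b : Fin (N - 1)) :
    pad (fun k => M k (leftSite b)) (rightSite b + 2) = crossEntry M (rightSite b) := by
  by_cases h : (rightSite b : ℕ) + 1 < N
  · rw [crossEntry, dif_pos ⟨Nat.succ_pos b, h⟩, hM]
    exact pad_succ (fun k => M k (leftSite b)) h
  · rw [crossEntry, dif_neg fun h' => h h'.2, pad_of_lt _ (by omega)]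

theorem two_lam_smul_Z (T : Matrix (Fin N) (Fin N) ℝ) :
    (2 * p.lam) • p.Z T = p.Φ N * p.U T - p.U T * p.Φ N := by
  have h1 := p.V_eq T
  rw [p.V_eq' T, sub_eq_iff_eq_add] at h1
  rw [h1, mul_smul, two_smul]
  abel

theorem Φ_mul_apply (M : Matrix (Fin N) (Fin N) ℝ) (i j : Fin N) :
    (p.Φ N * M) i j = (2 * p.ω ^ 2 + p.γ ^ 2) * M i j -
      p.ω ^ 2 * (pad (fun k => M k j) i + pad (fun k => M k j) (i + 2)) :=
  p.Φ_mulVec_apply (fun k => M k j) i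

theorem mul_Φ_apply (M : Matrix (Fin N) (Fin N) ℝ) (i j : Fin N) :
    (M * p.Φ N) i j = (p.Φ N * Mᵀ) j i := by
  rw [← transpose_apply (M * p.Φ N), transpose_mul, p.Φ_transpose]

/-- The current is a discrete gradient. -/
theorem two_lam_mul_Z_eq (T : Fin N → ℝ) (b : Fin (N - 1)) :
    2 * p.lam * p.Z (diagonal T) (leftSite b) (rightSite b) =
      p.ω ^ 2 * (potential (p.U (diagonal T)) (leftSite b) -
        potential (p.U (diagonal T)) (rightSite b)) := by
  have hs := p.U_diagonal_comm T
  have hst : (p.U (diagonal T))ᵀ = p.U (diagonal T) := by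
    rw [p.U_transpose, diagonal_transpose]
  -- In this entry of [Φ, U] the diagonal part of Φ cancels. What remains is two differences of U;
  -- the zero padding at the chain ends matches the default value in `crossEntry`.
  have h := congrFun₂ (p.two_lam_smul_Z (diagonal T)) (leftSite b) (rightSite b)
  rw [Matrix.smul_apply, smul_eq_mul, Matrix.sub_apply, mul_Φ_apply, hst, Φ_mul_apply, Φ_mul_apply,
    pad_left, pad_right hs] at h
  have e1 : pad (fun k => p.U (diagonal T) k (rightSite b)) (leftSite b + 2) =
      p.U (diagonal T) (rightSite b) (rightSite b) :=
    pad_succ (fun k => p.U (diagonal T) k (rightSite b)) (rightSite b).2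
  have e2 : pad (fun k => p.U (diagonal T) k (leftSite b)) (rightSite b) =
      p.U (diagonal T) (leftSite b) (leftSite b) :=
    pad_succ (fun k => p.U (diagonal T) k (leftSite b)) (leftSite b).2
  rw [e1, e2, hs (rightSite b) (leftSite b)] at h
  rw [h, potential, potential]
  ring

/-- Energy conservation: in a balanced state, the current is the same on all bonds. -/
theorem IsBalanced.Z_eq {T : Fin N → ℝ} (hT : p.IsBalanced T) (b c : Fin (N - 1)) :
    p.Z (diagonal T) (leftSite b) (rightSite b) = p.Z (diagonal T) (leftSite c) (rightSite c) := by
  have hω := p.ω_pos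
  have step : ∀ (n : ℕ) (h : n + 1 < N - 1),
      p.Z (diagonal T) (leftSite ⟨n + 1, h⟩) (rightSite ⟨n + 1, h⟩) =
      p.Z (diagonal T) (leftSite ⟨n, by omega⟩) (rightSite ⟨n, by omega⟩) := by
    intro n h
    set i : Fin N := ⟨n + 1, by omega⟩ with hi
    -- Balance at i cancels the bath terms, so [Φ, Z]_ii = 0, which equates the currents on the two
    -- bonds meeting at i.
    have hb := congrFun₂ (p.energy_balance (diagonal T)) i i
    have hZt : (p.Z (diagonal T))ᵀ = -p.Z (diagonal T) := by
      rw [Z_transpose, diagonal_transpose]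
    have hV := hT i (by simp [hi]) (by simp [hi]; omega)
    simp only [Matrix.add_apply, Matrix.sub_apply, Matrix.smul_apply, smul_eq_mul,
      diagonal_apply_eq, hV, mul_Φ_apply, hZt, mul_neg, Matrix.neg_apply] at hb
    rw [Φ_mul_apply] at hb
    have h0 : p.Z (diagonal T) i i = 0 := by
      have := p.Z_diagonal_comm T i i
      linarith
    have e1 : pad (fun k => p.Z (diagonal T) k i) i = p.Z (diagonal T) ⟨n, by omega⟩ i :=
      pad_succ (fun k => p.Z (diagonal T) k i) (by omega : n < N)
    have e2 : pad (fun k => p.Z (diagonal T) k i) (i + 2) =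
        p.Z (diagonal T) ⟨n + 2, by omega⟩ i :=
      pad_succ (fun k => p.Z (diagonal T) k i) (by omega : n + 2 < N)
    rw [e1, e2, h0, p.Z_diagonal_comm T ⟨n + 2, by omega⟩ i] at hb
    change p.Z (diagonal T) i ⟨n + 2, _⟩ = p.Z (diagonal T) ⟨n, _⟩ i
    have h3 : p.ω ^ 2 * (p.Z (diagonal T) i ⟨n + 2, by omega⟩ -
      p.Z (diagonal T) ⟨n, by omega⟩ i) = 0 := by linarith
    rcases mul_eq_zero.1 h3 with h4 | h4
    · exact absurd h4 (by positivity)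
    · linarith
  have key : ∀ (n : ℕ) (h : n < N - 1),
      p.Z (diagonal T) (leftSite ⟨n, h⟩) (rightSite ⟨n, h⟩) =
      p.Z (diagonal T) (leftSite ⟨0, by omega⟩) (rightSite ⟨0, by omega⟩) := by
    intro n
    induction n with
    | zero => intro h; rfl
    | succ n ih => intro h; rw [step n h, ih]
  exact (key b b.2).trans (key c c.2).symm

/-- If the gradient of the potential is constant, the potential is affine. -/
theorem potential_eq {T : Fin N → ℝ} {z : ℝ} (hN : 0 < N)
    (hz : ∀ b : Fin (N - 1), p.Z (diagonal T) (leftSite b) (rightSite b) = z) (i : Fin N) :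
    potential (p.U (diagonal T)) i =
      potential (p.U (diagonal T)) ⟨0, hN⟩ - (i : ℝ) * (2 * p.lam / p.ω ^ 2 * z) := by
  have hω := p.ω_pos
  have key : ∀ (n : ℕ) (h : n < N), potential (p.U (diagonal T)) ⟨n, h⟩ =
      potential (p.U (diagonal T)) ⟨0, hN⟩ - (n : ℝ) * (2 * p.lam / p.ω ^ 2 * z) := by
    intro n
    induction n with
    | zero => intro h; simp
    | succ n ih =>
      intro h
      have h1 := ih (by omega)
      have h2 := p.two_lam_mul_Z_eq T ⟨n, by omega⟩
      rw [hz] at h2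
      change _ = p.ω ^ 2 * (potential (p.U (diagonal T)) ⟨n, _⟩ -
        potential (p.U (diagonal T)) ⟨n + 1, _⟩) at h2
      have h3 : 2 * p.lam / p.ω ^ 2 * z = potential (p.U (diagonal T)) ⟨n, by omega⟩ -
        potential (p.U (diagonal T)) ⟨n + 1, h⟩ := by
        rw [div_mul_eq_mul_div, h2]; field_simp
      push_cast
      rw [h1] at h3
      linarith
  exact key i i.2

/-! ### Local comparison of the potential with the temperature. -/

/-- The corner entry of the inverse force matrix. -/
noncomputable def corner (hN : 0 < N) : ℝ :=
  p.U (1 : Matrix (Fin N) (Fin N) ℝ) ⟨0, hN⟩ ⟨0, hN⟩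

/-- At equilibrium Z = 0, so the potential is constant; at the first site its cross entry is 0 by
default. -/
theorem potential_one (hN : 0 < N) (i : Fin N) :
    potential (p.U (1 : Matrix (Fin N) (Fin N) ℝ)) i = p.corner hN := by
  have h := p.potential_eq (T := fun _ => 1) (z := 0) hN (fun b => ?_) i
  · rw [diagonal_one] at h
    rw [h]
    simp [potential, crossEntry, corner]
  · rw [diagonal_one, (p.blocks_one N).2.1]
    rfl

theorem abs_apply_le_of_posSemidef {M : Matrix (Fin N) (Fin N) ℝ} (hM : M.PosSemidef)
    (a b : Fin N) : |M a b| ≤ (M a a + M b b) / 2 := by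
  have h := abs_dotProduct_mulVec_le hM (Pi.single a 1) (Pi.single b 1)
  simp only [mulVec_single_one, single_one_dotProduct, col_apply] at h
  have ha := Real.mul_self_sqrt (hM.diag_nonneg (i := a))
  have hb := Real.mul_self_sqrt (hM.diag_nonneg (i := b))
  nlinarith [sq_nonneg (√(M a a) - √(M b b))]

/-- Both εW - S and εW + S are nonnegative, so both covariances are positive semidefinite; half the
difference of their (a, b) entries is the entry sought. -/
theorem abs_U_diagonal_le {S W : Fin N → ℝ} {ε : ℝ} (h : ∀ k, |S k| ≤ ε * W k) (a b : Fin N) :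
    |p.U (diagonal S) a b| ≤
      ε * (p.U (diagonal W) a a + p.U (diagonal W) b b) / 2 := by
  have h1 : (ε • diagonal W - diagonal S).PosSemidef := by
    rw [← diagonal_smul]
    exact posSemidef_diagonal_sub fun k => le_of_abs_le (h k)
  have h2 : (ε • diagonal W + diagonal S).PosSemidef := by
    have : (diagonal (ε • W) - diagonal (-S)).PosSemidef :=
      posSemidef_diagonal_sub fun k => by
        have := neg_le_of_abs_le (h k)
        simp only [Pi.neg_apply, Pi.smul_apply, smul_eq_mul]
        linarith
    have e : diagonal (-S) = -diagonal S := by rw [diagonal_neg]; rfl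
    rwa [diagonal_smul, e, sub_neg_eq_add] at this
  have h3 := abs_apply_le_of_posSemidef (p.U_posSemidef h1) a b
  have h4 := abs_apply_le_of_posSemidef (p.U_posSemidef h2) a b
  simp only [map_sub, map_add, map_smul, Matrix.sub_apply, Matrix.add_apply, Matrix.smul_apply,
    smul_eq_mul] at h3 h4
  rw [abs_le] at h3 h4 ⊢
  constructor <;> linarith

/-- The constant in the comparison of the potential with the temperature. -/
noncomputable def localConst : ℝ := p.majSlope + 2 * p.majConst

theorem localConst_pos : 0 < p.localConst := by
  have := p.majSlope_pos
  have := p.majConst_pos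
  unfold localConst; positivity

theorem abs_potential_le {S : Fin N → ℝ} {ε : ℝ} (hε : 0 ≤ ε) {j : Fin N}
    (h : ∀ k, |S k| ≤ ε * parabola j k) :
    |potential (p.U (diagonal S)) j| ≤ p.localConst * ε := by
  have hα := p.majSlope_pos
  have hβ := p.majConst_pos
  have h1 : |p.U (diagonal S) j j| ≤ ε * p.majConst := by
    have h2 := p.abs_U_diagonal_le h j j
    have h3 := p.U_parabola_le j j
    simp only [sub_self, ne_eq, OfNat.ofNat_ne_zero, not_false_eq_true, zero_pow, mul_zero,
      zero_add] at h3
    nlinarith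
  have h2 : |crossEntry (p.U (diagonal S)) j| ≤ ε * (p.majSlope + p.majConst) := by
    unfold crossEntry
    split_ifs with hj
    · refine (p.abs_U_diagonal_le h _ _).trans ?_
      have h3 := p.U_parabola_le j ⟨j - 1, by omega⟩
      have h4 := p.U_parabola_le j ⟨j + 1, hj.2⟩
      have e3 : (((⟨j - 1, by omega⟩ : Fin N) : ℕ) : ℝ) - j = -1 := by
        have : (((j : ℕ) - 1 : ℕ) : ℝ) = (j : ℝ) - 1 := by
          rw [Nat.cast_sub hj.1]; simp
        simp only [this]; ring
      have e4 : (((⟨j + 1, hj.2⟩ : Fin N) : ℕ) : ℝ) - j = 1 := by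
        push_cast; ring
      rw [e3] at h3
      rw [e4] at h4
      nlinarith
    · simp only [abs_zero]; positivity
  have h3 := abs_sub (p.U (diagonal S) j j) (crossEntry (p.U (diagonal S)) j)
  unfold potential localConst
  linarith

/-- The potential is proportional to the local temperature up to the variation of the profile. -/
theorem abs_potential_sub_le (hN : 0 < N) (T : Fin N → ℝ) (j : Fin N) :
    |potential (p.U (diagonal T)) j - T j * p.corner hN| ≤ p.localConst * maxVariation T := by
  have e : diagonal (fun k => T k - T j) = diagonal T - T j • (1 : Matrix (Fin N) (Fin N) ℝ) := by
    rw [← diagonal_one, ← diagonal_smul, diagonal_sub]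
    congr 1
    ext k
    simp
  -- Subtracting the constant profile T_j leaves |T_k - T_j| ≤ ε|k - j| ≤ ε(1 + (k - j)²), which the
  -- parabola controls.
  have h := p.abs_potential_le (S := fun k => T k - T j) (maxVariation_nonneg T) (j := j) fun k => by
    refine (abs_sub_le_dist_mul_maxVariation T k j).trans ?_
    rw [mul_comm]
    refine mul_le_mul_of_nonneg_left ?_ (maxVariation_nonneg T)
    unfold parabola
    rw [abs_le]
    constructor <;> nlinarith [sq_nonneg ((k : ℝ) - j + 1), sq_nonneg ((k : ℝ) - j - 1)]
  rwa [e, map_sub, map_smul, potential_sub_smul, p.potential_one hN] at h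

/-- This is 1 = (e·e)² ≤ (e·Φe)(e·Φ⁻¹e), in the form of positivity of Φ⁻¹ on ae - Φe. It permits
division by the corner entry uniformly in N. -/
theorem le_corner (hN : 0 < N) : 1 / (2 * p.ω ^ 2 + p.γ ^ 2) ≤ p.corner hN := by
  have hγ := p.γ_pos
  set a := 2 * p.ω ^ 2 + p.γ ^ 2 with ha
  have ha0 : 0 < a := by positivity
  set e : Fin N → ℝ := Pi.single ⟨0, hN⟩ 1 with he
  have hu := p.isUnit_Φ N
  have h := (p.U_posSemidef (PosSemidef.one (n := Fin N) (R := ℝ))).dotProduct_mulVec_nonneg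
    (a • e - p.Φ N *ᵥ e)
  have hee : e ⬝ᵥ e = 1 := by simp [he]
  have heΦe : (p.Φ N *ᵥ e) ⬝ᵥ e = a := by
    rw [dotProduct_comm]
    simp [he, Φ_diag, ha]
  have hc : e ⬝ᵥ (p.Φ N)⁻¹ *ᵥ e = p.corner hN := by
    rw [corner, (p.blocks_one N).1]
    simp [he]
  have hΦΦ : (p.Φ N *ᵥ e) ⬝ᵥ (p.Φ N)⁻¹ *ᵥ e = 1 := by
    rw [← p.dotProduct_Φ_comm, mulVec_mulVec, mul_nonsing_inv _ hu, one_mulVec, hee]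
  rw [star_trivial, (p.blocks_one N).1, mulVec_sub, mulVec_mulVec, nonsing_inv_mul _ hu,
    one_mulVec] at h
  simp only [mulVec_smul, dotProduct_sub, sub_dotProduct, smul_dotProduct, dotProduct_smul,
    smul_eq_mul, hee, heΦe, hc, hΦΦ] at h
  rw [div_le_iff₀ ha0]
  nlinarith

/-! ### Limit of the corner entry. -/

/-- The smaller root of `r + 1 / r = 2 + ν ^ 2`. -/
noncomputable def root : ℝ :=
  2 / (2 + nuSq p.ω p.γ + √(nuSq p.ω p.γ * (4 + nuSq p.ω p.γ)))

theorem root_spec : 0 < p.root ∧ p.root < 1 ∧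
    (2 * p.ω ^ 2 + p.γ ^ 2) * p.root = p.ω ^ 2 * (1 + p.root ^ 2) := by
  have hω := p.ω_pos
  have hγ := p.γ_pos
  set x := nuSq p.ω p.γ with hx
  have hx0 : 0 < x := by rw [hx, nuSq]; positivity
  have hxγ : p.ω ^ 2 * x = p.γ ^ 2 := by rw [hx, nuSq]; field_simp
  set s := √(x * (4 + x)) with hs
  have hs0 : 0 ≤ s := Real.sqrt_nonneg _
  have hs2 : s * s = x * (4 + x) := Real.mul_self_sqrt (by positivity)
  have hr : p.root = 2 / (2 + x + s) := rfl
  have hd : 0 < 2 + x + s := by positivity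
  refine ⟨by rw [hr]; positivity, by rw [hr, div_lt_one hd]; linarith, ?_⟩
  rw [← hxγ, hr]
  field_simp
  nlinarith

theorem abs_corner_sub_le (hN : 0 < N) :
    |p.corner hN - p.root / p.ω ^ 2| ≤ p.root ^ (N + 1) / p.γ ^ 2 := by
  have hω := p.ω_pos
  obtain ⟨hr0, hr1, hr⟩ := p.root_spec
  set r := p.root
  set i0 : Fin N := ⟨0, hN⟩ with hi0
  set l : Fin N := ⟨N - 1, by omega⟩ with hl
  set v : Fin N → ℝ := fun k => r ^ ((k : ℕ) + 1) with hv
  -- The geometric sequence solves the bulk recurrence. Cutting it off leaves a source at each end: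
  -- its value r^0 just left of the chain and r^(N+1) just right of it.
  have hΦv : p.Φ N *ᵥ v = p.ω ^ 2 • (Pi.single i0 1 : Fin N → ℝ) +
      (p.ω ^ 2 * r ^ (N + 1)) • (Pi.single l 1 : Fin N → ℝ) := by
    ext k
    rw [Φ_mulVec_apply]
    simp only [Pi.add_apply, Pi.smul_apply, smul_eq_mul, Pi.single_apply]
    have e1 : pad v k = r ^ (k : ℕ) - if k = i0 then 1 else 0 := by
      obtain ⟨n, hn⟩ := k
      rcases n with _ | n
      · simp [hi0]
      · rw [pad_succ v (by omega : n < N), if_neg (by simp [hi0])]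
        simp [hv]
    have e2 : pad v (k + 2) = r ^ ((k : ℕ) + 2) - if k = l then r ^ (N + 1) else 0 := by
      by_cases hk : (k : ℕ) + 1 < N
      · rw [pad_succ v hk, if_neg (by rw [hl, Fin.ext_iff]; simp; omega)]
        simp [hv]
      · rw [pad_of_lt v (by omega), if_pos (by rw [hl, Fin.ext_iff]; simp; omega)]
        have : (k : ℕ) + 2 = N + 1 := by omega
        rw [this]; ring
    rw [e1, e2]
    have e3 : (2 * p.ω ^ 2 + p.γ ^ 2) * v k = p.ω ^ 2 * (r ^ (k : ℕ) + r ^ ((k : ℕ) + 2)) := by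
      simp only [hv]
      calc _ = r ^ (k : ℕ) * ((2 * p.ω ^ 2 + p.γ ^ 2) * r) := by ring
        _ = _ := by rw [hr]; ring
    rw [e3]
    split_ifs <;> ring
  have h := congrArg (fun u => ((p.Φ N)⁻¹ *ᵥ u) i0) hΦv
  simp only [mulVec_mulVec, nonsing_inv_mul _ (p.isUnit_Φ N), one_mulVec, mulVec_add, mulVec_smul,
    mulVec_single_one, Pi.add_apply, Pi.smul_apply, col_apply, smul_eq_mul] at h
  have hU := p.abs_U_one_le i0 l
  rw [(p.blocks_one N).1] at hU
  have hc : (p.Φ N)⁻¹ i0 i0 = p.corner hN := by rw [corner, (p.blocks_one N).1]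
  have hv0 : v i0 = r := by simp [hv, hi0]
  rw [hc, hv0] at h
  have e : p.corner hN - r / p.ω ^ 2 = -(r ^ (N + 1) * (p.Φ N)⁻¹ i0 l) := by
    have e0 : r / p.ω ^ 2 = p.corner hN + r ^ (N + 1) * (p.Φ N)⁻¹ i0 l := by
      rw [div_eq_iff (by positivity)]
      linear_combination h
    rw [e0]; ring
  rw [e, abs_neg, abs_mul, abs_of_pos (by positivity)]
  calc _ ≤ r ^ (N + 1) * (1 / p.γ ^ 2) := by gcongr
    _ = _ := by ring

/-! ### From stationary measures to linear algebra. -/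

theorem noiseMatrix_mul_transpose {T : Fin N → ℝ} (hT : ∀ i, 0 ≤ T i) :
    noiseMatrix p.lam T * (noiseMatrix p.lam T)ᵀ = p.source N (diagonal T) := by
  have hlam := p.lam_pos
  change _ = fromBlocks 0 0 0 ((2 * p.lam) • diagonal T)
  rw [noiseMatrix, fromBlocks_transpose, fromBlocks_multiply]
  simp only [transpose_zero, diagonal_transpose, mul_zero, zero_mul, add_zero, zero_add,
    diagonal_mul_diagonal, ← diagonal_smul]
  congr 2
  ext i
  have : 0 ≤ 2 * p.lam * T i := mul_nonneg (by positivity) (hT i)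
  rw [Real.mul_self_sqrt this]
  rfl

theorem lawAt_eq_ouLaw {T : Fin N → ℝ} (hT : ∀ i, 0 ≤ T i) (t : ℝ)
    (μ : Measure (PhaseSpace N)) :
    lawAt p.ω p.γ p.lam T t μ = ouLaw (p.drift N) (p.source N (diagonal T)) t μ := by
  rw [← p.noiseMatrix_mul_transpose hT]
  rfl

theorem diagonal_posSemidef {T : Fin N → ℝ} (hT : ∀ i, 0 ≤ T i) : (diagonal T).PosSemidef :=
  PosSemidef.diagonal hT

/-- The stationary state is the Gaussian measure whose covariance solves the Lyapunov equation. -/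
theorem isStationary_iff {T : Fin N → ℝ} (hT : ∀ i, 0 ≤ T i) (μ : Measure (PhaseSpace N)) :
    IsStationary p.ω p.γ p.lam T μ ↔ μ = multivariateGaussian 0 (p.cov N (diagonal T)) := by
  have hD := p.source_posSemidef (diagonal_posSemidef hT)
  constructor
  · intro h
    have := h.isProbabilityMeasure
    refine eq_multivariateGaussian_of_ouLaw (p.isStable_drift N) hD μ fun t ht => ?_
    rw [← p.lawAt_eq_ouLaw hT]
    exact h.lawAt_eq t ht
  · rintro rfl
    refine ⟨inferInstance, fun t ht => ?_⟩
    rw [p.lawAt_eq_ouLaw hT]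
    exact ouLaw_multivariateGaussian (p.isStable_drift N) hD ht

theorem integrable_bathFlux (T : Fin N → ℝ) (S : Matrix (Fin N ⊕ Fin N) (Fin N ⊕ Fin N) ℝ)
    (i : Fin N) : Integrable (bathFlux p.lam T i) (multivariateGaussian 0 S) := by
  have h := integrable_mul_multivariateGaussian S (Sum.inr i) (Sum.inr i)
  simp only [← sq] at h
  exact ((integrable_const (T i)).sub h).const_mul p.lam

theorem integral_bathFlux {T : Fin N → ℝ} (hT : ∀ i, 0 ≤ T i) (i : Fin N) :
    ∫ x, bathFlux p.lam T i x ∂(multivariateGaussian 0 (p.cov N (diagonal T))) =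
      p.lam * (T i - p.V (diagonal T) i i) := by
  have h := integrable_mul_multivariateGaussian (p.cov N (diagonal T)) (Sum.inr i) (Sum.inr i)
  have h2 := integral_mul_multivariateGaussian
    (p.cov_posSemidef (diagonal_posSemidef hT)) (Sum.inr i) (Sum.inr i)
  simp only [← sq] at h h2
  simp only [bathFlux]
  rw [integral_const_mul, integral_sub (integrable_const _) h, h2, integral_const, probReal_univ,
    one_smul]
  rfl

theorem energyCurrent_eq (b : Fin (N - 1)) : energyCurrent p.ω b = fun x : PhaseSpace N =>
    -(p.ω ^ 2 / 2) * ((x (Sum.inl (rightSite b)) * x (Sum.inr (leftSite b)) +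
      x (Sum.inl (rightSite b)) * x (Sum.inr (rightSite b))) -
      (x (Sum.inl (leftSite b)) * x (Sum.inr (leftSite b)) +
      x (Sum.inl (leftSite b)) * x (Sum.inr (rightSite b)))) := by
  funext x
  rw [energyCurrent]
  ring

theorem integrable_energyCurrent (S : Matrix (Fin N ⊕ Fin N) (Fin N ⊕ Fin N) ℝ)
    (b : Fin (N - 1)) : Integrable (energyCurrent p.ω b) (multivariateGaussian 0 S) := by
  rw [energyCurrent_eq]
  have h := fun i j => integrable_mul_multivariateGaussian S (Sum.inl i) (Sum.inr j)
  exact (((h _ _).add (h _ _)).sub ((h _ _).add (h _ _))).const_mul _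

/-- Antisymmetry of Z removes the on-site correlations and makes the two remaining ones add up. -/
theorem integral_energyCurrent {T : Fin N → ℝ} (hT : ∀ i, 0 ≤ T i) (b : Fin (N - 1)) :
    ∫ x, energyCurrent p.ω b x ∂(multivariateGaussian 0 (p.cov N (diagonal T))) =
      p.ω ^ 2 * p.Z (diagonal T) (leftSite b) (rightSite b) := by
  have h := fun i j => integrable_mul_multivariateGaussian (p.cov N (diagonal T))
    (Sum.inl i) (Sum.inr j)
  have h2 : ∀ i j : Fin N, ∫ x : PhaseSpace N, x (Sum.inl i) * x (Sum.inr j)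
      ∂(multivariateGaussian 0 (p.cov N (diagonal T))) = p.Z (diagonal T) i j := fun i j =>
    integral_mul_multivariateGaussian (p.cov_posSemidef (diagonal_posSemidef hT)) _ _
  have i1 := integral_sub ((h (rightSite b) (leftSite b)).add (h (rightSite b) (rightSite b)))
    ((h (leftSite b) (leftSite b)).add (h (leftSite b) (rightSite b)))
  have i2 := integral_add (h (rightSite b) (leftSite b)) (h (rightSite b) (rightSite b))
  have i3 := integral_add (h (leftSite b) (leftSite b)) (h (leftSite b) (rightSite b))
  simp only [Pi.add_apply] at i1
  rw [energyCurrent_eq, integral_const_mul, i1, i2, i3, h2, h2, h2, h2]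
  have e1 := p.Z_diagonal_comm T (leftSite b) (leftSite b)
  have e2 := p.Z_diagonal_comm T (rightSite b) (rightSite b)
  have e3 := p.Z_diagonal_comm T (rightSite b) (leftSite b)
  have e1' : p.Z (diagonal T) (leftSite b) (leftSite b) = 0 := by linarith
  have e2' : p.Z (diagonal T) (rightSite b) (rightSite b) = 0 := by linarith
  rw [e3, e1', e2']
  ring

theorem isSelfConsistentState_iff {TL TR : ℝ} (T : Fin N → ℝ) (μ : Measure (PhaseSpace N)) :
    IsSelfConsistentState p.ω p.γ p.lam TL TR T μ ↔
      (∀ i, 0 ≤ T i) ∧ (∀ i : Fin N, (i : ℕ) = 0 → T i = TL) ∧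
      (∀ i : Fin N, (i : ℕ) + 1 = N → T i = TR) ∧ p.IsBalanced T ∧
      μ = multivariateGaussian 0 (p.cov N (diagonal T)) := by
  have hlam := p.lam_pos
  constructor
  · intro h
    have hμ := (p.isStationary_iff h.nonneg μ).1 h.stationary
    refine ⟨h.nonneg, h.left_end, h.right_end, fun i h0 h1 => ?_, hμ⟩
    have hf := h.flux_eq_zero i h0 h1
    rw [hμ, p.integral_bathFlux h.nonneg] at hf
    rcases mul_eq_zero.1 hf with h2 | h2
    · exact absurd h2 hlam.ne'
    · linarith
  · rintro ⟨h0, hl, hr, hb, rfl⟩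
    refine ⟨h0, hl, hr, (p.isStationary_iff h0 _).2 rfl, fun i _ _ => p.integrable_bathFlux T _ i,
      fun i hi hi' => ?_⟩
    rw [p.integral_bathFlux h0, hb i hi hi', sub_self, mul_zero]

theorem existsUnique_selfConsistentState (hN : 2 ≤ N) {TL TR : ℝ} (hTL : 0 ≤ TL) (hTR : 0 ≤ TR) :
    ∃! s : (Fin N → ℝ) × Measure (PhaseSpace N),
      IsSelfConsistentState p.ω p.γ p.lam TL TR s.1 s.2 := by
  obtain ⟨T, hb, hl, hr⟩ := p.exists_isBalanced hN TL TR
  have h0 : ∀ i, 0 ≤ T i := hb.le (fun i hi => by rw [hl i hi]; exact hTL)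
    fun i hi => by rw [hr i hi]; exact hTR
  refine ⟨(T, multivariateGaussian 0 (p.cov N (diagonal T))),
    (p.isSelfConsistentState_iff T _).2 ⟨h0, hl, hr, hb, rfl⟩, ?_⟩
  rintro ⟨S, μ⟩ hS
  obtain ⟨-, hl', hr', hb', hμ⟩ := (p.isSelfConsistentState_iff S μ).1 hS
  have : S = T := hb'.eq p hb (fun i hi => by rw [hl i hi, hl' i hi])
    fun i hi => by rw [hr i hi, hr' i hi]
  subst this
  rw [hμ]

/-! ### Linear profile and Fourier's law with explicit errors. -/

/-- The deviation of a balanced profile from the linear one. -/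
theorem IsBalanced.abs_sub_linearProfile_le (hN : 2 ≤ N) {T : Fin N → ℝ} (hT : p.IsBalanced T)
    {TL TR : ℝ} (hl : ∀ i : Fin N, (i : ℕ) = 0 → T i = TL)
    (hr : ∀ i : Fin N, (i : ℕ) + 1 = N → T i = TR) (j : Fin N) :
    |T j - linearProfile TL TR ((j : ℝ) / ((N : ℝ) - 1))| ≤
      2 * p.localConst * (2 * p.ω ^ 2 + p.γ ^ 2) * maxVariation T := by
  have hγ := p.γ_pos
  have hN' : (2 : ℝ) ≤ N := by exact_mod_cast hN
  have hN1 : (0 : ℝ) < (N : ℝ) - 1 := by linarith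
  have hN0 : 0 < N := by omega
  set g := p.corner hN0 with hg
  set c := p.localConst * maxVariation T with hc
  have hg1 := p.le_corner hN0
  have ha : 0 < 2 * p.ω ^ 2 + p.γ ^ 2 := by positivity
  have hg0 : 0 < g := lt_of_lt_of_le (by positivity) hg1
  have hP := p.potential_eq hN0 (fun b => hT.Z_eq p b ⟨0, by omega⟩)
  set x := 2 * p.lam / p.ω ^ 2 *
    p.Z (diagonal T) (leftSite ⟨0, by omega⟩) (rightSite ⟨0, by omega⟩)
  have hloc := p.abs_potential_sub_le hN0 T
  have h0 := hloc ⟨0, hN0⟩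
  have hj := hloc j
  have hL := hloc ⟨N - 1, by omega⟩
  rw [hl ⟨0, hN0⟩ rfl] at h0
  rw [hr ⟨N - 1, by omega⟩ (by simp; omega), hP ⟨N - 1, by omega⟩] at hL
  rw [hP j] at hj
  have eN : (((⟨N - 1, by omega⟩ : Fin N) : ℕ) : ℝ) = (N : ℝ) - 1 := by
    simp only
    rw [Nat.cast_sub (by omega)]; simp
  rw [eN] at hL
  set P := potential (p.U (diagonal T)) ⟨0, hN0⟩
  set θ := (j : ℝ) / ((N : ℝ) - 1) with hθ
  have hjθ : (j : ℝ) = θ * ((N : ℝ) - 1) := by rw [hθ]; field_simp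
  have hθ0 : 0 ≤ θ := by positivity
  have hθ1 : θ ≤ 1 := by
    rw [hθ, div_le_one hN1]
    have : ((j : ℕ) : ℝ) + 1 ≤ N := by exact_mod_cast j.2
    linarith
  -- Since the potential is affine, the deviation combines the local error at j with a convex
  -- combination of those at the two ends, each at most c.
  have key : |g * (T j - linearProfile TL TR θ)| ≤ 2 * c := by
    have e : g * (T j - linearProfile TL TR θ) = -(P - (j : ℝ) * x - T j * g) +
        ((1 - θ) * (P - TL * g) + θ * (P - ((N : ℝ) - 1) * x - TR * g)) := by
      rw [linearProfile, hjθ]; ring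
    rw [abs_le] at h0 hj hL
    rw [e, abs_le]
    have h1θ : 0 ≤ 1 - θ := by linarith
    have k1 := mul_le_mul_of_nonneg_left h0.1 h1θ
    have k2 := mul_le_mul_of_nonneg_left h0.2 h1θ
    have k3 := mul_le_mul_of_nonneg_left hL.1 hθ0
    have k4 := mul_le_mul_of_nonneg_left hL.2 hθ0
    constructor <;> linarith [hj.1, hj.2]
  rw [abs_mul, abs_of_pos hg0] at key
  have h1 : 1 ≤ (2 * p.ω ^ 2 + p.γ ^ 2) * g := by
    rw [div_le_iff₀ ha] at hg1
    linarith
  calc |T j - linearProfile TL TR θ|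
      ≤ ((2 * p.ω ^ 2 + p.γ ^ 2) * g) * |T j - linearProfile TL TR θ| :=
        le_mul_of_one_le_left (abs_nonneg _) h1
    _ = (2 * p.ω ^ 2 + p.γ ^ 2) * (g * |T j - linearProfile TL TR θ|) := by ring
    _ ≤ (2 * p.ω ^ 2 + p.γ ^ 2) * (2 * c) := by gcongr
    _ = _ := by rw [hc]; ring

theorem conductivity_eq : conductivity p.ω p.γ p.lam = p.ω ^ 2 * p.root / (2 * p.lam) := by
  have := p.lam_pos
  rw [conductivity, root]
  field_simp

/-- The deviation of the rescaled current from Fourier's law. -/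
theorem IsBalanced.abs_current_sub_le (hN : 2 ≤ N) {T : Fin N → ℝ} (hT : p.IsBalanced T)
    {TL TR : ℝ} (hl : ∀ i : Fin N, (i : ℕ) = 0 → T i = TL)
    (hr : ∀ i : Fin N, (i : ℕ) + 1 = N → T i = TR) (b : Fin (N - 1)) :
    |((N : ℝ) - 1) * (p.ω ^ 2 * p.Z (diagonal T) (leftSite b) (rightSite b)) -
        conductivity p.ω p.γ p.lam * (TL - TR)| ≤
      p.ω ^ 4 / (2 * p.lam) * (2 * p.localConst * maxVariation T +
        p.root ^ (N + 1) / p.γ ^ 2 * |TL - TR|) := by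
  have hγ := p.γ_pos
  have hω := p.ω_pos
  have hlam := p.lam_pos
  have hN0 : 0 < N := by omega
  have hP := p.potential_eq hN0 (fun c => hT.Z_eq p c b) ⟨N - 1, by omega⟩
  set z := p.Z (diagonal T) (leftSite b) (rightSite b)
  have hloc := p.abs_potential_sub_le hN0 T
  have h0 := hloc ⟨0, hN0⟩
  have hL := hloc ⟨N - 1, by omega⟩
  rw [hl ⟨0, hN0⟩ rfl] at h0
  rw [hr ⟨N - 1, by omega⟩ (by simp; omega), hP] at hL
  have eN : (((⟨N - 1, by omega⟩ : Fin N) : ℕ) : ℝ) = (N : ℝ) - 1 := by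
    simp only
    rw [Nat.cast_sub (by omega)]; simp
  rw [eN] at hL
  set P := potential (p.U (diagonal T)) ⟨0, hN0⟩
  set g := p.corner hN0
  have hg : |(g - p.root / p.ω ^ 2) * (TL - TR)| ≤ p.root ^ (N + 1) / p.γ ^ 2 * |TL - TR| := by
    rw [abs_mul]
    exact mul_le_mul_of_nonneg_right (p.abs_corner_sub_le hN0) (abs_nonneg _)
  -- Exact identity: the errors are the local comparisons at the two ends and the distance of the
  -- corner entry from its limit.
  have e : ((N : ℝ) - 1) * (p.ω ^ 2 * z) - conductivity p.ω p.γ p.lam * (TL - TR) =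
      p.ω ^ 4 / (2 * p.lam) * ((P - TL * g) -
        (P - ((N : ℝ) - 1) * (2 * p.lam / p.ω ^ 2 * z) - TR * g) +
        (g - p.root / p.ω ^ 2) * (TL - TR)) := by
    rw [conductivity_eq]
    field_simp
    ring
  rw [e, abs_mul, abs_of_pos (by positivity)]
  gcongr
  refine (abs_add_le _ _).trans (add_le_add ((abs_sub _ _).trans ?_) hg)
  linarith

end Params

end HarmonicChain

/-! ### Assembly of the theorem. -/

open HarmonicChain in
theorem mainTheorem2 (ω γ lam : ℝ) (hω : 0 < ω) (hγ : 0 < γ) (hlam : 0 < lam) :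
    ∃ C : ℝ, ∀ TL TR : ℝ, 0 ≤ TL → 0 ≤ TR →
      (∀ N : ℕ, 2 ≤ N →
        ∃! s : (Fin N → ℝ) × Measure (HarmonicChain.PhaseSpace N),
          HarmonicChain.IsSelfConsistentState ω γ lam TL TR s.1 s.2) ∧
      ∀ (T : (N : ℕ) → Fin N → ℝ) (μ : (N : ℕ) → Measure (HarmonicChain.PhaseSpace N)),
        (∀ N : ℕ, 2 ≤ N → HarmonicChain.IsSelfConsistentState ω γ lam TL TR (T N) (μ N)) →
        (∃ J : ℕ → ℝ,
          (∀ N : ℕ, 2 ≤ N → ∀ i : Fin (N - 1),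
            Integrable (HarmonicChain.energyCurrent ω i) (μ N) ∧
              ∫ x, HarmonicChain.energyCurrent ω i x ∂(μ N) = J N) ∧
          Tendsto (fun N : ℕ => ((N : ℝ) - 1) * J N) atTop
            (𝓝 (HarmonicChain.conductivity ω γ lam * (TL - TR)))) ∧
        (∀ N : ℕ, 2 ≤ N →
          HarmonicChain.maxVariation (T N) ≤ C * |TL - TR| * (N : ℝ) ^ (-(1 / 2) : ℝ)) ∧
        (∀ N : ℕ, 2 ≤ N → ∀ j : Fin N,
          |T N j - HarmonicChain.linearProfile TL TR ((j : ℝ) / ((N : ℝ) - 1))| ≤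
            C * HarmonicChain.maxVariation (T N)) ∧
        (∀ δ : ℝ, 0 < δ → ∃ N₀ : ℕ, 2 ≤ N₀ ∧ ∀ N : ℕ, N₀ ≤ N → ∀ j : Fin N,
          |T N j - HarmonicChain.linearProfile TL TR (((j : ℝ) + 1) / (N : ℝ))| < δ) := by
  let p : Params := ⟨ω, γ, lam, hω, hγ, hlam⟩
  set C₁ := p.variationConst with hC₁
  set C₂ := 2 * p.localConst * (2 * p.ω ^ 2 + p.γ ^ 2) with hC₂
  have hC₁0 : 0 ≤ C₁ := Real.sqrt_nonneg _
  have hC₂0 : 0 ≤ C₂ := by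
    have := p.localConst_pos
    positivity
  -- Both constants depend only on the parameters; their sum serves both estimates.
  refine ⟨C₁ + C₂, fun TL TR hTL hTR =>
    ⟨fun N hN => p.existsUnique_selfConsistentState hN hTL hTR, fun T μ hTμ => ?_⟩⟩
  have hst := fun N hN => (p.isSelfConsistentState_iff (T N) (μ N)).1 (hTμ N hN)
  have hvar : ∀ N : ℕ, 2 ≤ N →
      maxVariation (T N) ≤ (C₁ + C₂) * |TL - TR| * (N : ℝ) ^ (-(1 / 2) : ℝ) := by
    intro N hN
    obtain ⟨-, hl, hr, hb, -⟩ := hst N hN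
    refine (hb.maxVariation_le p hN hl hr).trans ?_
    gcongr
    linarith
  have hdev : ∀ N : ℕ, 2 ≤ N → ∀ j : Fin N,
      |T N j - linearProfile TL TR ((j : ℝ) / ((N : ℝ) - 1))| ≤
        (C₁ + C₂) * maxVariation (T N) := by
    intro N hN j
    obtain ⟨-, hl, hr, hb, -⟩ := hst N hN
    refine (hb.abs_sub_linearProfile_le p hN hl hr j).trans ?_
    have := maxVariation_nonneg (T N)
    gcongr
    linarith
  have hpow : Tendsto (fun N : ℕ => (N : ℝ) ^ (-(1 / 2) : ℝ)) atTop (𝓝 0) :=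
    (tendsto_rpow_neg_atTop (by norm_num : (0 : ℝ) < 1 / 2)).comp tendsto_natCast_atTop_atTop
  have hvar0 : Tendsto (fun N : ℕ => (C₁ + C₂) * |TL - TR| * (N : ℝ) ^ (-(1 / 2) : ℝ)) atTop
      (𝓝 0) := by
    simpa using hpow.const_mul ((C₁ + C₂) * |TL - TR|)
  refine ⟨?_, hvar, hdev, ?_⟩
  -- The current is read off on the first bond; the value 0 for N < 2 does not affect the limit.
  · refine ⟨fun N => if h : 2 ≤ N then ω ^ 2 * p.Z (Matrix.diagonal (T N))
      (leftSite ⟨0, by omega⟩) (rightSite ⟨0, by omega⟩) else 0, fun N hN i => ?_, ?_⟩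
    · obtain ⟨h0, hl, hr, hb, hμ⟩ := hst N hN
      rw [hμ]
      refine ⟨p.integrable_energyCurrent _ i, ?_⟩
      refine Eq.trans ?_ (dif_pos hN).symm
      exact (p.integral_energyCurrent h0 i).trans
        (congrArg (ω ^ 2 * ·) (hb.Z_eq p i ⟨0, by omega⟩))
    · rw [tendsto_iff_dist_tendsto_zero]
      obtain ⟨hr0, hr1, -⟩ := p.root_spec
      have hroot : Tendsto (fun N : ℕ => p.root ^ (N + 1)) atTop (𝓝 0) :=
        (tendsto_pow_atTop_nhds_zero_of_lt_one hr0.le hr1).comp (tendsto_add_atTop_nat 1)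
      have hlim : Tendsto (fun N : ℕ => ω ^ 4 / (2 * lam) * (2 * p.localConst *
          ((C₁ + C₂) * |TL - TR| * (N : ℝ) ^ (-(1 / 2) : ℝ)) +
          p.root ^ (N + 1) / γ ^ 2 * |TL - TR|)) atTop (𝓝 0) := by
        have h := ((hvar0.const_mul (2 * p.localConst)).add
          ((hroot.div_const (γ ^ 2)).mul_const |TL - TR|)).const_mul (ω ^ 4 / (2 * lam))
        simpa using h
      refine squeeze_zero' (Eventually.of_forall fun _ => dist_nonneg) ?_ hlim
      filter_upwards [eventually_ge_atTop 2] with N hN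
      obtain ⟨-, hl, hr, hb, -⟩ := hst N hN
      rw [dif_pos hN, Real.dist_eq]
      refine (hb.abs_current_sub_le p hN hl hr ⟨0, by omega⟩).trans ?_
      have h1 := hvar N hN
      have h2 := p.localConst_pos
      change ω ^ 4 / (2 * lam) * _ ≤ _
      gcongr
  · intro δ hδ
    have hinv : Tendsto (fun N : ℕ => |TL - TR| * (N : ℝ)⁻¹) atTop (𝓝 0) := by
      simpa using (tendsto_inv_atTop_zero.comp tendsto_natCast_atTop_atTop).const_mul |TL - TR|
    have hlim : Tendsto (fun N : ℕ => (C₁ + C₂) * ((C₁ + C₂) * |TL - TR| *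
        (N : ℝ) ^ (-(1 / 2) : ℝ)) + |TL - TR| * (N : ℝ)⁻¹) atTop (𝓝 0) := by
      simpa using (hvar0.const_mul (C₁ + C₂)).add hinv
    obtain ⟨N₁, hN₁⟩ := eventually_atTop.1 (hlim.eventually (gt_mem_nhds hδ))
    refine ⟨max 2 N₁, le_max_left _ _, fun N hN j => ?_⟩
    have hN2 : 2 ≤ N := (le_max_left _ _).trans hN
    have hN' : (2 : ℝ) ≤ N := by exact_mod_cast hN2
    have hN1 : (0 : ℝ) < (N : ℝ) - 1 := by linarith
    refine lt_of_le_of_lt ?_ (hN₁ N ((le_max_right _ _).trans hN))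
    have hj : ((j : ℕ) : ℝ) + 1 ≤ N := by exact_mod_cast j.2
    have hj0 : (0 : ℝ) ≤ (j : ℕ) := Nat.cast_nonneg _
    -- With sites numbered from 0, the points j/(N-1) and (j+1)/N differ by at most 1/N.
    have h1 : |linearProfile TL TR ((j : ℝ) / ((N : ℝ) - 1)) -
        linearProfile TL TR (((j : ℝ) + 1) / N)| ≤ |TL - TR| * (N : ℝ)⁻¹ := by
      have e : linearProfile TL TR ((j : ℝ) / ((N : ℝ) - 1)) -
          linearProfile TL TR (((j : ℝ) + 1) / N) =
          (TL - TR) * (((N : ℝ) - 1 - j) / ((N : ℝ) - 1) * (N : ℝ)⁻¹) := by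
        unfold linearProfile
        field_simp
        ring
      rw [e, abs_mul]
      refine mul_le_mul_of_nonneg_left ?_ (abs_nonneg _)
      have h2 : 0 ≤ ((N : ℝ) - 1 - j) / ((N : ℝ) - 1) := div_nonneg (by linarith) hN1.le
      have h3 : ((N : ℝ) - 1 - j) / ((N : ℝ) - 1) ≤ 1 := by
        rw [div_le_one hN1]; linarith
      rw [abs_of_nonneg (by positivity)]
      exact mul_le_of_le_one_left (by positivity) h3
    have h2 := (hdev N hN2 j).trans (mul_le_mul_of_nonneg_left (hvar N hN2) (by positivity))
    have h3 := abs_sub_le (T N j) (linearProfile TL TR ((j : ℝ) / ((N : ℝ) - 1)))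
      (linearProfile TL TR (((j : ℝ) + 1) / N))
    linarith
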